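/- Let $\Sigma$ be a finite alphabet. A transducer $T=(Q,I,F,\Delta,i,t)$ over $\Sigma$ has a finite state set $Q$, initial states $I$, final states $F$, a partial transition function $\Delta:Q\times\Sigma\times Q\rightharpoonup\Sigma^*$, an initial function $i:I\to\Sigma^*$ and a terminal function $t:F\to\Sigma^*$; we write $p\xrightarrow{\sigma\mid u}q$ for $\Delta(p,\sigma,q)=u$. It realizes the relation of all pairs $(w,\,i(p)\,x\,t(q))$ with $p\in I$, $q\in F$ such that there is a run from $p$ to $q$ with input $w$ and output $x$; it defines the partial function $f:\Sigma^*\rightharpoonup\Sigma^*$ if this relation is the graph of $f$. It is trim if every state lies on a successful run. A partial function is subsequential if it is defined by a finite deterministic transducer. A variety $\mathbf V$ is a class of finite monoids closed under finite direct products, submonoids and homomorphic images. The transition congruence of a left or right automaton with state set $Q$ (a right automaton reads words from right to left) is: $w\equiv w'$ iff for all $p,q\in Q$ there is a run from $p$ to $q$ on $w$ exactly when there is one on $w'$. A finite automaton is a $\mathbf V$-automaton if its transition monoid $\Sigma^*/{\equiv}$ is in $\mathbf V$; a transducer is a $\mathbf V$-transducer if its underlying automaton is a $\mathbf V$-automaton;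 a bimachine is a $\mathbf V$-bimachine if both its left and its right automaton are $\mathbf V$-automata. For a nonempty set $X$ of words let $\bigwedge X$ be their longest common prefix. The determinization of a transducer $T$ is the deterministic transducer whose states are sets of pairs $(q,w)\in Q\times\Sigma^*$, built as follows. If $I\neq\varnothing$, put $i'=\bigwedge\{i(q):q\in I\}$; the initial state is $\{(q,w): q\in I,\ i(q)=i'w\}$ with initial output $i'$. From a state $S$ and a letter $\sigma$, let $S'=\{(q,vu): (p,v)\in S,\ p\xrightarrow{\sigma\mid u}q\}$; if $S'\ne\varnothing$ and $s=\bigwedge\{w:(q,w)\in S'\}$, there is a transition with input $\sigma$ and output $s$ from $S$ to the state $\{(q,w):(q,sw)\in S'\}$. The states are those obtained in this way from the initial one (none if $I=\varnothing$); a state is final if it contains a pair $(q,w)$ with $q\in F$, with terminal output $w\,t(q)$. The variety $\mathbf V$ is stable by determinization of transducers if, for every finite alphabet and every trim $\mathbf V$-transducer $T$ defining a subsequential function, the determinization of $T$ is a $\mathbf V$-transducer. Let $f:\Sigma^*\rightharpoonup\Sigma^*$ be defined by a transducer. For words $x,y$ let $\lVert x,y\rVert=|x|+|y|-2|x\wedge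 y|$, where $x\wedge y$ is the longest common prefix. Let $u\sim_{R_0}v$ iff for all $w$, $wu\in\mathrm{dom}(f)\Leftrightarrow wv\in\mathrm{dom}(f)$, and $\lVert f(wu),f(wv)\rVert$ is bounded over all $w$ with $wu\in\mathrm{dom}(f)$. This is a left congruence; let $R_0=\Sigma^*/{\sim_{R_0}}$ be the deterministic right automaton with initial state $r_0=[\varepsilon]$ and transitions $\sigma\cdot[u]=[\sigma u]$. For $r\in R_0$ let $\widehat f_r(u)=\bigwedge\{f(uv): [v]=r,\ uv\in\mathrm{dom}(f)\}$, defined when this set is nonempty. Let $u\sim_{L^0}v$ iff for all $w\in\Sigma^*$, $\sigma\in\Sigma$, $r\in R_0$, $$\widehat f_{\sigma r}(uw)^{-1}\widehat f_r(uw\sigma)=\widehat f_{\sigma r}(vw)^{-1}\widehat f_r(vw\sigma),\qquad \widehat f_{r_0}(uw)^{-1}f(uw)=\widehat f_{r_0}(vw)^{-1}f(vw),$$ where each equality means that both sides are undefined, or both are defined and equal. This is a right congruence; let $L^0=\Sigma^*/{\sim_{L^0}}$ be the deterministic left automaton with initial state $[\varepsilon]$ and transitions $[u]\cdot\sigma=[u\sigma]$.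 The canonical bimachine of $f$ is $B^0=(L^0,R_0,\omega^0,\lambda^0,\rho^0)$ with $\omega^0([u],\sigma,r)=\widehat f_{\sigma r}(u)^{-1}\widehat f_r(u\sigma)$, $\lambda^0(r)=\widehat f_r(\varepsilon)$, $\rho^0([u])=\widehat f_{r_0}(u)^{-1}f(u)$. Corollary. Let $\mathbf V$ be a variety that is stable by determinization of transducers and let $f$ be defined by a $\mathbf V$-transducer. Then the canonical bimachine $B^0$ of $f$ is a $\mathbf V$-bimachine, that is, $L^0$ and $R_0$ are (finite) $\mathbf V$-automata. -/

import Mathlib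

universe u

noncomputable section

namespace RationalFunctions

/-! ### Automata, transition congruences and varieties -/

/-- The transition congruence of a (left) automaton: `w ≡ w'` iff for all states `p`, `q`, there is
a run from `p` to `q` on `w` iff there is one on `w'`. -/
def transitionCon {α Q : Type u} (A : NFA α Q) : Con (FreeMonoid α) where
  r w w' := ∀ p q : Q, q ∈ A.evalFrom {p} w.toList ↔ q ∈ A.evalFrom {p} w'.toList
  iseqv :=
    ⟨fun _ _ _ => Iff.rfl, fun h p q => (h p q).symm, fun h h' p q => (h p q).trans (h' p q)⟩
  mul' := by
    intro w x y z h h' p q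
    simp only [FreeMonoid.toList_mul, NFA.evalFrom_append]
    rw [NFA.mem_evalFrom_iff_exists, NFA.mem_evalFrom_iff_exists (S := A.evalFrom {p} x.toList)]
    exact exists_congr fun t => and_congr (h p t) (h' t q)

/-- The transition congruence of a right automaton, that is, of an automaton which reads its input
from right to left. Multiplication of words is still concatenation. -/
def rightTransitionCon {α Q : Type u} (A : NFA α Q) : Con (FreeMonoid α) where
  r w w' := ∀ p q : Q,
    q ∈ A.evalFrom {p} w.toList.reverse ↔ q ∈ A.evalFrom {p} w'.toList.reverse
  iseqv :=
    ⟨fun _ _ _ => Iff.rfl, fun h p q => (h p q).symm, fun h h' p q => (h p q).trans (h' p q)⟩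
  mul' := by
    intro w x y z h h' p q
    simp only [FreeMonoid.toList_mul, List.reverse_append, NFA.evalFrom_append]
    rw [NFA.mem_evalFrom_iff_exists,
      NFA.mem_evalFrom_iff_exists (S := A.evalFrom {p} z.toList.reverse)]
    exact exists_congr fun t => and_congr (h' p t) (h t q)

/-- A class of monoids. -/
abbrev MonoidClass := (M : Type u) → [Monoid M] → Prop

/-- A monoid (pseudo)variety: a class of finite monoids closed under finite direct products
(the empty product and binary products), submonoids and homomorphic images. -/
structure IsVariety (V : MonoidClass.{u}) : Prop where
  finite : ∀ (M : Type u) [Monoid M], V M → Finite M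
  one : V PUnit.{u + 1}
  prod : ∀ (M N : Type u) [Monoid M] [Monoid N], V M → V N → V (M × N)
  submonoid : ∀ (M : Type u) [Monoid M] (S : Submonoid M), V M → V S
  image : ∀ (M N : Type u) [Monoid M] [Monoid N] (φ : M →* N),
    Function.Surjective φ → V M → V N

/-- A finite (left) automaton whose transition monoid is in `V`. -/
def IsVAutomaton (V : MonoidClass.{u}) {α Q : Type u} (A : NFA α Q) : Prop :=
  Finite Q ∧ V (transitionCon A).Quotient

/-- A finite right automaton whose transition monoid is in `V`. -/
def IsRightVAutomaton (V : MonoidClass.{u}) {α Q : Type u} (A : NFA α Q) : Prop :=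
  Finite Q ∧ V (rightTransitionCon A).Quotient

/-! ### Words -/

theorem exists_lcp {α : Type u} (X : Set (List α)) (hX : X.Nonempty) :
    ∃ p : List α, (∀ x ∈ X, p <+: x) ∧ ∀ q : List α, (∀ x ∈ X, q <+: x) → q <+: p := by
  classical
  obtain ⟨x₀, hx₀⟩ := hX
  let P : ℕ → Prop := fun n => ∃ q : List α, q.length = n ∧ ∀ x ∈ X, q <+: x
  have h0 : P 0 := ⟨[], rfl, fun x _ => List.nil_prefix⟩
  obtain ⟨p, hp, hpX⟩ := Nat.findGreatest_spec (P := P) (Nat.zero_le x₀.length) h0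
  refine ⟨p, hpX, fun q hq => ?_⟩
  have hle : q.length ≤ p.length := by
    rw [hp]
    exact Nat.le_findGreatest (hq x₀ hx₀).length_le ⟨q, rfl, hq⟩
  exact List.prefix_of_prefix_length_le (hq x₀ hx₀) (hpX x₀ hx₀) hle

open Classical in
/-- The longest common prefix of the words of a nonempty set `X` (and `[]` if `X` is empty). -/
def lcp {α : Type u} (X : Set (List α)) : List α :=
  if hX : X.Nonempty then (exists_lcp X hX).choose else []

theorem lcp_prefix {α : Type u} {X : Set (List α)} {x : List α} (hx : x ∈ X) : lcp X <+: x := by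
  have hX : X.Nonempty := ⟨x, hx⟩
  rw [lcp, dif_pos hX]
  exact (exists_lcp X hX).choose_spec.1 x hx

theorem prefix_lcp {α : Type u} {X : Set (List α)} (hX : X.Nonempty) {q : List α}
    (hq : ∀ x ∈ X, q <+: x) : q <+: lcp X := by
  rw [lcp, dif_pos hX]
  exact (exists_lcp X hX).choose_spec.2 q hq

open Classical in
/-- The word `x⁻¹ y`, defined when `x` is a prefix of `y`. -/
def leftQuotient {α : Type u} (x y : List α) : Option (List α) :=
  if x <+: y then some (y.drop x.length) else none

/-- The left distance `|x| + |y| - 2 |x ∧ y|`. -/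
def leftDist {α : Type u} (x y : List α) : ℕ :=
  x.length + y.length - 2 * (lcp {x, y}).length

theorem leftDist_self {α : Type u} (x : List α) : leftDist x x = 0 := by
  have h : x <+: lcp {x, x} := prefix_lcp ⟨x, by simp⟩ (by simp)
  have := h.length_le
  unfold leftDist
  omega

theorem leftDist_comm {α : Type u} (x y : List α) : leftDist x y = leftDist y x := by
  unfold leftDist
  rw [Set.pair_comm, Nat.add_comm]

theorem leftDist_triangle {α : Type u} (x y z : List α) :
    leftDist x z ≤ leftDist x y + leftDist y z := by
  have hx : lcp {x, y} <+: x := lcp_prefix (by simp)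
  have hy : lcp {x, y} <+: y := lcp_prefix (by simp)
  have hy' : lcp {y, z} <+: y := lcp_prefix (by simp)
  have hz : lcp {y, z} <+: z := lcp_prefix (by simp)
  have key : (lcp {x, y}).length ≤ (lcp {x, z}).length ∨
      (lcp {y, z}).length ≤ (lcp {x, z}).length := by
    rcases le_total (lcp {x, y}).length (lcp {y, z}).length with h | h
    · left
      have h1 : lcp {x, y} <+: z := (List.prefix_of_prefix_length_le hy hy' h).trans hz
      have h2 : lcp {x, y} <+: lcp {x, z} := prefix_lcp ⟨x, by simp⟩ (by simp [hx, h1])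
      exact h2.length_le
    · right
      have h1 : lcp {y, z} <+: x := (List.prefix_of_prefix_length_le hy' hy h).trans hx
      have h2 : lcp {y, z} <+: lcp {x, z} := prefix_lcp ⟨x, by simp⟩ (by simp [hz, h1])
      exact h2.length_le
  have := hx.length_le
  have := hy.length_le
  have := hy'.length_le
  have := hz.length_le
  unfold leftDist
  omega

/-! ### Transducers -/

/-- A nondeterministic (real-time) transducer with state set `Q`. The partial functions are written
with `Option`: `init` is the initial function, with domain the set of initial states, `term` is the
terminal function, with domain the set of final states, and `step p a q = some v` is the transition
from `p` to `q` with input `a` and output `v`. -/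
structure Transducer (α Q : Type u) where
  init : Q → Option (List α)
  step : Q → α → Q → Option (List α)
  term : Q → Option (List α)

namespace Transducer

variable {α Q : Type u}

/-- `T.Run p w x q`: there is a run of `T` from `p` to `q` with input `w` and output `x`. -/
inductive Run (T : Transducer α Q) : Q → List α → List α → Q → Prop
  | nil (q : Q) : Run T q [] [] q
  | cons {p q r : Q} {a : α} {v w x : List α} :
      T.step p a q = some v → Run T q w x r → Run T p (a :: w) (v ++ x) r

/-- The pair `(w, v)` belongs to the transduction realized by `T`. -/
def Realizes (T : Transducer α Q) (w v : List α) : Prop :=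
  ∃ (p q : Q) (x y z : List α),
    T.init p = some x ∧ T.Run p w y q ∧ T.term q = some z ∧ v = x ++ y ++ z

/-- `T` is functional and defines the partial function `f`. -/
def Defines (T : Transducer α Q) (f : List α → Option (List α)) : Prop :=
  ∀ w v, T.Realizes w v ↔ f w = some v

/-- Every state appears in a successful run. -/
def IsTrim (T : Transducer α Q) : Prop :=
  ∀ q : Q, (∃ p w x, (T.init p).isSome ∧ T.Run p w x q) ∧
    (∃ r w x, T.Run q w x r ∧ (T.term r).isSome)

/-- A unique initial state, and at most one transition from each state on each letter. -/
def IsDeterministic (T : Transducer α Q) : Prop :=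
  (∃! q : Q, (T.init q).isSome) ∧
    ∀ p a q q', (T.step p a q).isSome → (T.step p a q').isSome → q = q'

/-- The underlying automaton, obtained by forgetting the outputs. -/
def underlying (T : Transducer α Q) : NFA α Q where
  step p a := {q | (T.step p a q).isSome}
  start := {q | (T.init q).isSome}
  accept := {q | (T.term q).isSome}

/-! #### Determinization -/

/-- The initial output `i'` of the determinized transducer. -/
def detInitWord (T : Transducer α Q) : List α := lcp {x | ∃ q, T.init q = some x}

/-- The initial state `{(q, w) | i(q) = i' w}` of the determinized transducer. -/
def detInit (T : Transducer α Q) : Set (Q × List α) :=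
  {s | T.init s.1 = some (T.detInitWord ++ s.2)}

/-- The pairs `(q, v u)` such that `(p, v) ∈ P` and `T` has a transition from `p` to `q` with input
`a` and output `u`. -/
def detImage (T : Transducer α Q) (P : Set (Q × List α)) (a : α) : Set (Q × List α) :=
  {s | ∃ p v u, (p, v) ∈ P ∧ T.step p a s.1 = some u ∧ s.2 = v ++ u}

/-- The output of the transition of the determinized transducer from `P` on `a`. -/
def detOut (T : Transducer α Q) (P : Set (Q × List α)) (a : α) : List α :=
  lcp (Prod.snd '' T.detImage P a)

/-- The target of the transition of the determinized transducer from `P` on `a`. -/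
def detNext (T : Transducer α Q) (P : Set (Q × List α)) (a : α) : Set (Q × List α) :=
  {s | (s.1, T.detOut P a ++ s.2) ∈ T.detImage P a}

/-- The states of the determinized transducer: the sets that are built from the initial one. -/
inductive DetReach (T : Transducer α Q) : Set (Q × List α) → Prop
  | init : (∃ q, (T.init q).isSome) → DetReach T T.detInit
  | step {P : Set (Q × List α)} (a : α) :
      DetReach T P → (T.detImage P a).Nonempty → DetReach T (T.detNext P a)

open Classical in
/-- The transducer obtained from `T` by determinization. There is no transition from `P` on `a` when
no transition of `T` applies. If `T` is trim and functional then the word `w ++ z` in the definition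
of the terminal function does not depend on the choice of `(q, w) ∈ P` with `q` final. -/
def determinize (T : Transducer α Q) : Transducer α {P : Set (Q × List α) // T.DetReach P} where
  init P := if P.1 = T.detInit then some T.detInitWord else none
  step P a P' :=
    if (T.detImage P.1 a).Nonempty ∧ P'.1 = T.detNext P.1 a then some (T.detOut P.1 a) else none
  term P :=
    if h : ∃ y, ∃ q w z, (q, w) ∈ P.1 ∧ T.term q = some z ∧ y = w ++ z then some h.choose else none

end Transducer

/-- A function is subsequential if some finite deterministic transducer defines it. -/
def IsSubsequential {α : Type u} (f : List α → Option (List α)) : Prop :=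
  ∃ (Q : Type u) (_ : Finite Q) (T : Transducer α Q), T.IsDeterministic ∧ T.Defines f

/-- A finite transducer whose transition monoid is in `V`. -/
def IsVTransducer (V : MonoidClass.{u}) {α Q : Type u} (T : Transducer α Q) : Prop :=
  IsVAutomaton V T.underlying

/-- Stability of `V` under determinization of transducers: whenever a (functional, trim)
`V`-transducer over a finite alphabet defines a subsequential function, the transducer obtained from
it by determinization is again a `V`-transducer. -/
def StableByDeterminization (V : MonoidClass.{u}) : Prop :=
  ∀ (α Q : Type u) [Finite α] (T : Transducer α Q) (f : List α → Option (List α)),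
    T.IsTrim → T.Defines f → IsSubsequential f → IsVTransducer V T → IsVTransducer V T.determinize

/-! ### Bimachines -/

/-- A bimachine: a deterministic left automaton, a deterministic right automaton (which reads its
input from right to left), a partial output function and partial terminal functions. The accepting
states of the two automata play no role. -/
structure Bimachine (α L R : Type u) where
  left : DFA α L
  right : DFA α R
  omega : L → α → R → Option (List α)
  lam : R → Option (List α)
  rho : L → Option (List α)

/-- A bimachine both of whose automata are `V`-automata. -/
def IsVBimachine (V : MonoidClass.{u}) {α L R : Type u} (B : Bimachine α L R) : Prop :=
  IsVAutomaton V B.left.toNFA ∧ IsRightVAutomaton V B.right.toNFA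

/-- A left congruence on the set of words. -/
structure LeftCongruence (α : Type u) extends Setoid (List α) where
  cons : ∀ (a : α) {v w : List α}, r v w → r (a :: v) (a :: w)

/-- A right congruence on the set of words. -/
structure RightCongruence (α : Type u) extends Setoid (List α) where
  append : ∀ (a : α) {v w : List α}, r v w → r (v ++ [a]) (w ++ [a])

namespace LeftCongruence

variable {α : Type u}

/-- The set of classes of a left congruence. -/
abbrev Classes (R : LeftCongruence α) : Type u := Quotient R.toSetoid

/-- The left action `[w] ↦ [a w]`. -/
def act (R : LeftCongruence α) (a : α) : R.Classes → R.Classes :=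
  Quotient.map (fun w => a :: w) fun _ _ h => R.cons a h

/-- The deterministic right automaton associated with a left congruence. -/
def automaton (R : LeftCongruence α) : DFA α R.Classes where
  step r a := R.act a r
  start := Quotient.mk _ []
  accept := ∅

end LeftCongruence

namespace RightCongruence

variable {α : Type u}

/-- The set of classes of a right congruence. -/
abbrev Classes (L : RightCongruence α) : Type u := Quotient L.toSetoid

/-- The deterministic left automaton associated with a right congruence. -/
def automaton (L : RightCongruence α) : DFA α L.Classes where
  step l a := Quotient.map (fun w => w ++ [a]) (fun _ _ h => L.append a h) l
  start := Quotient.mk _ []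
  accept := ∅

end RightCongruence

section Canonical

variable {α : Type u}

/-- The left syntactic congruence of `f`: `v ∼ w` iff, for all `x`, `x v` is in the domain of `f`
iff `x w` is, and the left distance between `f (x v)` and `f (x w)` is bounded over all `x`. -/
def leftSyntactic (f : List α → Option (List α)) : LeftCongruence α where
  r v w := (∀ x, (f (x ++ v)).isSome ↔ (f (x ++ w)).isSome) ∧
    ∃ K : ℕ, ∀ x y z, f (x ++ v) = some y → f (x ++ w) = some z → leftDist y z ≤ K
  iseqv := by
    refine ⟨fun v => ⟨fun _ => Iff.rfl, 0, fun x y z hy hz => ?_⟩, ?_, ?_⟩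
    · obtain rfl : y = z := by simpa [hy] using hz
      exact (leftDist_self y).le
    · rintro v w ⟨h, K, hK⟩
      exact ⟨fun x => (h x).symm, K, fun x y z hy hz => leftDist_comm z y ▸ hK x z y hz hy⟩
    · rintro u v w ⟨h, K, hK⟩ ⟨h', K', hK'⟩
      refine ⟨fun x => (h x).trans (h' x), K + K', fun x y z hy hz => ?_⟩
      obtain ⟨t, ht⟩ := Option.isSome_iff_exists.1 ((h x).1 (by simp [hy]))
      exact (leftDist_triangle y t z).trans (Nat.add_le_add (hK x y t hy ht) (hK' x t z ht hz))
  cons := by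
    rintro a v w ⟨h, K, hK⟩
    refine ⟨fun x => ?_, K, fun x y z hy hz => ?_⟩
    · simpa using h (x ++ [a])
    · exact hK (x ++ [a]) y z (by simpa using hy) (by simpa using hz)

variable (f : List α → Option (List α)) (R : LeftCongruence α)

open Classical in
/-- The longest common prefix of the words `f (w v)`, where `v` runs over the class `r` and `w v` is
in the domain of `f`; it is defined when there is such a word. -/
def fhat (r : R.Classes) (w : List α) : Option (List α) :=
  if {y | ∃ v, Quotient.mk R.toSetoid v = r ∧ f (w ++ v) = some y}.Nonempty then
    some (lcp {y | ∃ v, Quotient.mk R.toSetoid v = r ∧ f (w ++ v) = some y})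
  else none

/-- The partial value of `fhat (a r) w` inverse times `fhat r (w a)`. -/
def omegaWord (w : List α) (a : α) (r : R.Classes) : Option (List α) :=
  (fhat f R (R.act a r) w).bind fun x => (fhat f R r (w ++ [a])).bind fun y => leftQuotient x y

/-- The partial value of `fhat r₀ w` inverse times `f w`, where `r₀` is the class of the empty
word. -/
def rhoWord (w : List α) : Option (List α) :=
  (fhat f R (Quotient.mk _ []) w).bind fun x => (f w).bind fun y => leftQuotient x y

/-- The right congruence associated with `f` and `R`; the equalities are equalities of partial
values, i.e. both sides are undefined, or both are defined and equal. -/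
def rightCongruence : RightCongruence α where
  r v w := ∀ x : List α,
    (∀ (a : α) (r : R.Classes), omegaWord f R (v ++ x) a r = omegaWord f R (w ++ x) a r) ∧
      rhoWord f R (v ++ x) = rhoWord f R (w ++ x)
  iseqv := ⟨fun _ _ => ⟨fun _ _ => rfl, rfl⟩,
    fun h x => ⟨fun a r => ((h x).1 a r).symm, (h x).2.symm⟩,
    fun h h' x => ⟨fun a r => ((h x).1 a r).trans ((h' x).1 a r), (h x).2.trans (h' x).2⟩⟩
  append := by
    intro a v w h x
    simpa using h (a :: x)

/-- The bimachine associated with `f` and a left congruence `R`. -/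
def bimachineOf : Bimachine α (rightCongruence f R).Classes R.Classes where
  left := (rightCongruence f R).automaton
  right := R.automaton
  omega l a r := Quotient.lift (fun w => omegaWord f R w a r)
    (fun v w h => by simpa using (h []).1 a r) l
  lam r := fhat f R r []
  rho := Quotient.lift (fun w => rhoWord f R w) (fun v w h => by simpa using (h []).2)

/-- The canonical bimachine of `f`. -/
def canonicalBimachine :
    Bimachine α (rightCongruence f (leftSyntactic f)).Classes (leftSyntactic f).Classes :=
  bimachineOf f (leftSyntactic f)

end Canonical

end RationalFunctions

end

namespace RationalFunctions

/-! ### Varieties and congruences -/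

section Varieties

variable {V : MonoidClass.{u}} {P : Type u} [Monoid P]

/-! Let `φ` be the transition morphism of the given transducer, onto a monoid `M` of `V`. The right
automaton is the easy half: words with the same value under `φ` are left syntactically equivalent
(`Transducer.Defines.leftSyntactic_of_transitionCon`), so `V`-membership passes to a quotient.

For the left automaton it suffices to find a two-sided congruence with quotient in `V` that refines
the right congruence. Call a letter `b` between a prefix of value `x₀` and a suffix of value `y₀`
irreversible if no element of `M` undoes it on both sides. The congruence used identifies words with
the same value under `φ` and the same irreversible crossings `(x₀, b, y₀)`.

Its quotient is in `V` because of stability. An irreversible triple is crossed at most once in a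
word, so a transducer guessing prefix and suffix values can announce the crossing by one extra
letter and remain functional. An extra silent run blocks all output of the determinization, whose
states must then remember whether the crossing took place (`exists_con_crosses`).

It refines the right congruence because of delays, the elements `f(wz)⁻¹ f(wz')` of the free group
for left syntactically equivalent `z`, `z'`. Only finitely many delays occur, and roots in a free
group are unique, so a loop in the context leaves the delay unchanged (`Factorizes.delay_loop`).
Reversible stretches are replaced by means of loops and irreversible letters are matched one by one,
hence the delay depends only on the value and the irreversible crossings of `w`
(`Factorizes.delay_eq_of_crossesLE`). Equal delays mean that the families of values of `f` after two
such words differ only by a change of prefix (`exists_common_suffixes`), and the outputs of the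
bimachine do not see this prefix. -/

theorem IsVariety.ker (hV : IsVariety V) {M : Type u} [Monoid M] (g : P →* M) (hM : V M) :
    V (Con.ker g).Quotient :=
  hV.image _ _ (Con.quotientKerEquivRange g).symm.toMonoidHom
    (Con.quotientKerEquivRange g).symm.surjective (hV.submonoid _ _ hM)

theorem IsVariety.mono (hV : IsVariety V) {c d : Con P} (h : c ≤ d) (hc : V c.Quotient) :
    V d.Quotient := by
  refine hV.image _ _ (Con.map c d h) ?_ hc
  intro x
  induction x using Con.induction_on with
  | H w => exact ⟨(w : c.Quotient), rfl⟩

theorem IsVariety.exists_le_inf (hV : IsVariety V) {c d : Con P} (hc : V c.Quotient)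
    (hd : V d.Quotient) : ∃ e : Con P, V e.Quotient ∧ e ≤ c ∧ e ≤ d := by
  refine ⟨Con.ker (c.mk'.prod d.mk'), hV.ker _ (hV.prod _ _ hc hd), ?_, ?_⟩
  · intro x y h
    exact (Con.eq c).1 (Prod.ext_iff.1 (Con.ker_rel _ |>.1 h)).1
  · intro x y h
    exact (Con.eq d).1 (Prod.ext_iff.1 (Con.ker_rel _ |>.1 h)).2

theorem IsVariety.exists_le_of_finite (hV : IsVariety V) {ι : Type*} [Finite ι] (c : ι → Con P)
    (hc : ∀ i, V (c i).Quotient) : ∃ e : Con P, V e.Quotient ∧ ∀ i, e ≤ c i := by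
  classical
  have key : ∀ s : Finset ι, ∃ e : Con P, V e.Quotient ∧ ∀ i ∈ s, e ≤ c i := by
    intro s
    induction s using Finset.induction_on with
    | empty => exact ⟨Con.ker (1 : P →* PUnit.{u + 1}), hV.ker _ hV.one, by simp⟩
    | insert i s _ ih =>
      obtain ⟨e, he, hes⟩ := ih
      obtain ⟨e', he', h1, h2⟩ := hV.exists_le_inf he (hc i)
      refine ⟨e', he', fun j hj => ?_⟩
      rcases Finset.mem_insert.1 hj with rfl | hj
      · exact h2
      · exact h1.trans (hes j hj)
  have := Fintype.ofFinite ι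
  obtain ⟨e, he, h⟩ := key Finset.univ
  exact ⟨e, he, fun i => h i (Finset.mem_univ i)⟩

end Varieties

/-! ### Automata of one-sided congruences -/

section Automata

variable {α Q : Type u}

theorem mem_toNFA_evalFrom (A : DFA α Q) (p q : Q) (w : List α) :
    q ∈ A.toNFA.evalFrom {p} w ↔ q = A.evalFrom p w := by
  rw [DFA.toNFA_evalFrom_match, Set.mem_singleton_iff]

theorem RightCongruence.automaton_evalFrom (L : RightCongruence α) (u w : List α) :
    L.automaton.evalFrom (Quotient.mk L.toSetoid u) w = Quotient.mk L.toSetoid (u ++ w) := by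
  induction w generalizing u with
  | nil => simp
  | cons a w ih =>
    rw [DFA.evalFrom_cons]
    exact (ih (u ++ [a])).trans (by simp)

theorem LeftCongruence.automaton_evalFrom_reverse (R : LeftCongruence α) (u w : List α) :
    R.automaton.evalFrom (Quotient.mk R.toSetoid u) w.reverse =
      Quotient.mk R.toSetoid (w ++ u) := by
  induction w with
  | nil => simp
  | cons a w ih =>
    rw [List.reverse_cons, DFA.evalFrom_of_append, ih]
    rfl

variable {V : MonoidClass.{u}}

/-- A right congruence containing a two-sided congruence with quotient in `V` gives a
`V`-automaton. -/
theorem RightCongruence.isVAutomaton (hV : IsVariety V) (L : RightCongruence α)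
    {c : Con (FreeMonoid α)} (hc : V c.Quotient)
    (h : ∀ v w : FreeMonoid α, c v w → L.r v.toList w.toList) :
    IsVAutomaton V L.automaton.toNFA := by
  refine ⟨?_, hV.mono (c := c) ?_ hc⟩
  · have : Finite (Quotient c.toSetoid) := hV.finite c.Quotient hc
    refine Finite.of_surjective (Quotient.map' (s₁ := c.toSetoid) (s₂ := L.toSetoid)
      FreeMonoid.toList h : c.Quotient → L.Classes) ?_
    intro x
    induction x using Quotient.inductionOn with
    | h w => exact ⟨Quotient.mk'' (FreeMonoid.ofList w), rfl⟩
  · intro v w hvw p q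
    induction p using Quotient.inductionOn with
    | h u =>
      rw [mem_toNFA_evalFrom, mem_toNFA_evalFrom, L.automaton_evalFrom, L.automaton_evalFrom]
      have : L.r (u ++ v.toList) (u ++ w.toList) :=
        h (FreeMonoid.ofList u * v) (FreeMonoid.ofList u * w) (c.mul (c.refl _) hvw)
      rw [Quotient.sound (s := L.toSetoid) this]

/-- A left congruence containing a two-sided congruence with quotient in `V` gives a right
`V`-automaton. -/
theorem LeftCongruence.isRightVAutomaton (hV : IsVariety V) (R : LeftCongruence α)
    {c : Con (FreeMonoid α)} (hc : V c.Quotient)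
    (h : ∀ v w : FreeMonoid α, c v w → R.r v.toList w.toList) :
    IsRightVAutomaton V R.automaton.toNFA := by
  refine ⟨?_, hV.mono (c := c) ?_ hc⟩
  · have : Finite (Quotient c.toSetoid) := hV.finite c.Quotient hc
    refine Finite.of_surjective (Quotient.map' (s₁ := c.toSetoid) (s₂ := R.toSetoid)
      FreeMonoid.toList h : c.Quotient → R.Classes) ?_
    intro x
    induction x using Quotient.inductionOn with
    | h w => exact ⟨Quotient.mk'' (FreeMonoid.ofList w), rfl⟩
  · intro v w hvw p q
    induction p using Quotient.inductionOn with
    | h u =>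
      rw [mem_toNFA_evalFrom, mem_toNFA_evalFrom, R.automaton_evalFrom_reverse,
        R.automaton_evalFrom_reverse]
      have : R.r (v.toList ++ u) (w.toList ++ u) :=
        h (v * FreeMonoid.ofList u) (w * FreeMonoid.ofList u) (c.mul hvw (c.refl _))
      rw [Quotient.sound (s := R.toSetoid) this]

end Automata

/-! ### Words in the free group -/

section Words

variable {α : Type u}

theorem lcp_image_append (q : List α) {X : Set (List α)} (hX : X.Nonempty) :
    lcp ((q ++ ·) '' X) = q ++ lcp X := by
  have h1 : q <+: lcp ((q ++ ·) '' X) := prefix_lcp (hX.image _) (by simp)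
  obtain ⟨s, hs⟩ := h1
  have h2 : q ++ lcp X <+: lcp ((q ++ ·) '' X) := prefix_lcp (hX.image _) (by
    rintro _ ⟨x, hx, rfl⟩
    exact (List.prefix_append_right_inj q).2 (lcp_prefix hx))
  rw [← hs] at h2 ⊢
  have h3 : s <+: lcp X := prefix_lcp hX fun x hx => by
    have := lcp_prefix (Set.mem_image_of_mem (q ++ ·) hx)
    rw [← hs] at this
    exact (List.prefix_append_right_inj q).1 this
  have h4 := (List.prefix_append_right_inj q).1 h2
  rw [h3.eq_of_length (le_antisymm h3.length_le h4.length_le)]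

theorem leftQuotient_append (q x y : List α) :
    leftQuotient (q ++ x) (q ++ y) = leftQuotient x y := by
  unfold leftQuotient
  rw [List.length_append, ← List.drop_drop, List.drop_left]
  by_cases h : x <+: y
  · rw [if_pos h, if_pos ((List.prefix_append_right_inj q).2 h)]
  · rw [if_neg h, if_neg fun h' => h ((List.prefix_append_right_inj q).1 h')]

theorem leftDist_append_le (q x y : List α) :
    leftDist (q ++ x) (q ++ y) ≤ x.length + y.length := by
  have : q <+: lcp {q ++ x, q ++ y} := prefix_lcp ⟨q ++ x, by simp⟩ (by simp)
  have := this.length_le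
  unfold leftDist
  simp only [List.length_append]
  omega

theorem exists_append_of_leftDist_le {y z : List α} {K : ℕ} (h : leftDist y z ≤ K) :
    ∃ q y' z', y = q ++ y' ∧ z = q ++ z' ∧ y'.length ≤ K ∧ z'.length ≤ K := by
  obtain ⟨y', hy⟩ : lcp {y, z} <+: y := lcp_prefix (by simp)
  obtain ⟨z', hz⟩ : lcp {y, z} <+: z := lcp_prefix (by simp)
  refine ⟨_, y', z', hy.symm, hz.symm, ?_⟩
  have h1 := congrArg List.length hy
  have h2 := congrArg List.length hz
  rw [List.length_append] at h1 h2
  unfold leftDist at h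
  omega

/-- The embedding of words into the free group. -/
def wordToGroup (w : List α) : FreeGroup α := FreeGroup.mk (w.map fun a => (a, true))

@[simp]
theorem wordToGroup_append (v w : List α) :
    wordToGroup (v ++ w) = wordToGroup v * wordToGroup w := by
  simp [wordToGroup, FreeGroup.mul_mk]

/-- Two words without a common first letter. -/
def HeadsDiffer (s t : List α) : Prop := ∀ a s' t', ¬(s = a :: s' ∧ t = a :: t')

/-- Within `s⁻¹` and within `t` all signs agree, so cancellation could only occur where they meet,
between the two first letters. -/
theorem isReduced_of_headsDiffer {s t : List α} (h : HeadsDiffer s t) :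
    FreeGroup.IsReduced (s.reverse.map (fun a => (a, false)) ++ t.map fun a => (a, true)) := by
  unfold FreeGroup.IsReduced
  rw [List.isChain_append]
  refine ⟨?_, ?_, ?_⟩
  · rw [List.isChain_map]
    exact List.Pairwise.isChain (List.pairwise_of_forall (by simp))
  · rw [List.isChain_map]
    exact List.Pairwise.isChain (List.pairwise_of_forall (by simp))
  · cases s <;> cases t <;> simp
    rename_i a s b t
    rintro rfl
    exact h a s t ⟨rfl, rfl⟩

theorem inv_wordToGroup_mul (s t : List α) : (wordToGroup s)⁻¹ * wordToGroup t =
    FreeGroup.mk (s.reverse.map (fun a => (a, false)) ++ t.map fun a => (a, true)) := by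
  rw [wordToGroup, wordToGroup, FreeGroup.inv_mk, FreeGroup.mul_mk]
  simp [FreeGroup.invRev, Function.comp_def]

theorem eq_of_headsDiffer {s s' t t' : List α} (h : HeadsDiffer s s') (h' : HeadsDiffer t t')
    (heq : (wordToGroup s)⁻¹ * wordToGroup s' = (wordToGroup t)⁻¹ * wordToGroup t') :
    s = t ∧ s' = t' := by
  classical
  rw [inv_wordToGroup_mul, inv_wordToGroup_mul] at heq
  have := FreeGroup.reduce.sound heq
  rw [(isReduced_of_headsDiffer h).reduce_eq, (isReduced_of_headsDiffer h').reduce_eq] at this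
  -- The negative letters of the common reduced word spell the first component, the positive ones
  -- the second.
  have h1 := congrArg (fun l => (l.filter fun x => !x.2).map Prod.fst) this
  have h2 := congrArg (fun l => (l.filter fun x => x.2).map Prod.fst) this
  simp [List.filter_append, List.filter_map, Function.comp_def] at h1 h2
  exact ⟨h1, h2⟩

/-- Stripping common first letters from `t` and `t'` preserves the quotient and ends with a pair
with different heads, which must be the reduced pair `s`, `s'`. -/
theorem exists_append_of_headsDiffer {s s' : List α} (h : HeadsDiffer s s') (t t' : List α)
    (heq : (wordToGroup s)⁻¹ * wordToGroup s' = (wordToGroup t)⁻¹ * wordToGroup t') :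
    ∃ e, t = e ++ s ∧ t' = e ++ s' := by
  induction t generalizing t' with
  | nil =>
    obtain ⟨rfl, rfl⟩ := eq_of_headsDiffer h (by rintro a _ _ ⟨h, -⟩; cases h) heq
    exact ⟨[], rfl, rfl⟩
  | cons a t ih =>
    by_cases hd : HeadsDiffer (a :: t) t'
    · obtain ⟨rfl, rfl⟩ := eq_of_headsDiffer h hd heq
      exact ⟨[], rfl, rfl⟩
    · simp only [HeadsDiffer, not_forall, not_not] at hd
      obtain ⟨b, t₁, t₂, h1, rfl⟩ := hd
      obtain ⟨rfl, rfl⟩ := List.cons_eq_cons.1 h1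
      obtain ⟨e, rfl, rfl⟩ := ih t₂ (by
        rw [heq, ← List.singleton_append (l := t), ← List.singleton_append (l := t₂)]
        simp only [wordToGroup_append]
        group)
      exact ⟨a :: e, rfl, rfl⟩

/-- Otherwise the first letter of `c i` would be a prefix of every word of the family. If `c i` is
empty, `i` itself can serve as `j`. -/
theorem exists_headsDiffer {J : Type*} (c : J → List α) (hc : lcp (Set.range c) = []) (i : J) :
    ∃ j, HeadsDiffer (c i) (c j) := by
  by_contra! hcon
  simp only [HeadsDiffer, not_forall, not_not] at hcon
  obtain ⟨a, s, -, hs, -⟩ := hcon i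
  have : [a] <+: lcp (Set.range c) := prefix_lcp (Set.range_nonempty_iff_nonempty.2 ⟨i⟩) (by
    rintro _ ⟨j, rfl⟩
    obtain ⟨b, s', t', h1, h2⟩ := hcon j
    obtain ⟨rfl, rfl⟩ := List.cons_eq_cons.1 (hs.symm.trans h1)
    exact ⟨t', h2.symm⟩)
  rw [hc] at this
  simpa using this.length_le

theorem exists_eq_lcp_append {J : Type*} [Nonempty J] (a : J → List α) :
    ∃ (q : List α) (c : J → List α), (∀ j, a j = q ++ c j) ∧ lcp (Set.range c) = [] := by
  have h : ∀ j, ∃ c, lcp (Set.range a) ++ c = a j := fun j => lcp_prefix ⟨j, rfl⟩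
  choose c hc using h
  refine ⟨lcp (Set.range a), c, fun j => (hc j).symm, ?_⟩
  have := lcp_image_append (lcp (Set.range a)) (Set.range_nonempty c)
  rw [← Set.range_comp, show (lcp (Set.range a) ++ ·) ∘ c = a from funext hc] at this
  exact List.append_right_eq_self.1 this.symm

/-- Two families of words with the same relative positions in the free group differ only by a
change of prefix. -/
theorem exists_common_suffixes {J : Type*} [Nonempty J] (a b : J → List α)
    (h : ∀ i j, (wordToGroup (a i))⁻¹ * wordToGroup (a j) =
      (wordToGroup (b i))⁻¹ * wordToGroup (b j)) :
    ∃ (p q : List α) (c : J → List α), (∀ j, a j = p ++ c j) ∧ ∀ j, b j = q ++ c j := by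
  obtain ⟨p, c, hc, hc0⟩ := exists_eq_lcp_append a
  obtain ⟨q, d, hd, hd0⟩ := exists_eq_lcp_append b
  have h' : ∀ i j, (wordToGroup (c i))⁻¹ * wordToGroup (c j) =
      (wordToGroup (d i))⁻¹ * wordToGroup (d j) := by
    intro i j
    have := h i j
    simp only [hc, hd, wordToGroup_append, mul_inv_rev] at this
    simpa [mul_assoc] using this
  refine ⟨p, q, c, hc, fun j => ?_⟩
  -- By symmetry each of `c j` and `d j` is a suffix of the other: pair each with a partner having a
  -- different head. The lengths then force the extra prefix to be empty.
  obtain ⟨i, hi⟩ := exists_headsDiffer c hc0 j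
  obtain ⟨k, hk⟩ := exists_headsDiffer d hd0 j
  obtain ⟨e, he, -⟩ := exists_append_of_headsDiffer hi _ _ (h' j i)
  obtain ⟨e', he', -⟩ := exists_append_of_headsDiffer hk _ _ (h' j k).symm
  have h1 := congrArg List.length he
  have h2 := congrArg List.length he'
  rw [List.length_append] at h1 h2
  have : e = [] := List.length_eq_zero_iff.1 (by omega)
  rw [hd, he, this, List.nil_append]

/-- The longest common prefix cancels in the quotient, leaving two words of length at most `K` over
a finite alphabet. -/
theorem finite_wordToGroup_quotients [Finite α] (K : ℕ) :
    {g : FreeGroup α | ∃ y z, leftDist y z ≤ K ∧ g = (wordToGroup y)⁻¹ * wordToGroup z}.Finite := by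
  have hfin := List.finite_length_le α K
  refine ((hfin.prod hfin).image
    fun s : List α × List α => (wordToGroup s.1)⁻¹ * wordToGroup s.2).subset ?_
  rintro _ ⟨y, z, h, rfl⟩
  obtain ⟨q, y', z', rfl, rfl, h1, h2⟩ := exists_append_of_leftDist_le h
  refine ⟨(y', z'), ⟨h1, h2⟩, ?_⟩
  simp only [wordToGroup_append]
  group

end Words

/-! ### Runs of transducers -/

namespace Transducer

variable {α Q : Type u} {T : Transducer α Q}

theorem run_nil_iff {p q : Q} {v : List α} : T.Run p [] v q ↔ p = q ∧ v = [] := by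
  constructor
  · intro h
    cases h
    exact ⟨rfl, rfl⟩
  · rintro ⟨rfl, rfl⟩
    exact .nil p

theorem run_cons_iff {p q : Q} {a : α} {w v : List α} :
    T.Run p (a :: w) v q ↔
      ∃ s x y, T.step p a s = some x ∧ T.Run s w y q ∧ v = x ++ y := by
  constructor
  · rintro (_ | ⟨h, h'⟩)
    exact ⟨_, _, _, h, h', rfl⟩
  · rintro ⟨s, x, y, h, h', rfl⟩
    exact .cons h h'

theorem run_append_iff {p q : Q} {w w' v : List α} :
    T.Run p (w ++ w') v q ↔ ∃ s x y, T.Run p w x s ∧ T.Run s w' y q ∧ v = x ++ y := by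
  induction w generalizing p v with
  | nil =>
    simp only [List.nil_append, run_nil_iff]
    constructor
    · intro h
      exact ⟨p, [], v, ⟨rfl, rfl⟩, h, rfl⟩
    · rintro ⟨s, x, y, ⟨rfl, rfl⟩, h, rfl⟩
      exact h
  | cons a w ih =>
    simp only [List.cons_append, run_cons_iff, ih]
    constructor
    · rintro ⟨s, x, _, h, ⟨t, y, z, h1, h2, rfl⟩, rfl⟩
      exact ⟨t, x ++ y, z, ⟨s, x, y, h, h1, rfl⟩, h2, by simp⟩
    · rintro ⟨t, _, z, ⟨s, x, y, h, h1, rfl⟩, h2, rfl⟩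
      exact ⟨s, x, y ++ z, h, ⟨t, y, z, h1, h2, rfl⟩, by simp⟩

theorem run_append_singleton_iff {p q : Q} {w v : List α} {a : α} :
    T.Run p (w ++ [a]) v q ↔
      ∃ s x y, T.Run p w x s ∧ T.step s a q = some y ∧ v = x ++ y := by
  rw [run_append_iff]
  constructor
  · rintro ⟨s, x, y, h, h', rfl⟩
    obtain ⟨t, y, z, h1, h2, rfl⟩ := run_cons_iff.1 h'
    obtain ⟨rfl, rfl⟩ := run_nil_iff.1 h2
    exact ⟨s, x, y, h, h1, by simp⟩
  · rintro ⟨s, x, y, h, h', rfl⟩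
    exact ⟨s, x, y, h, run_cons_iff.2 ⟨q, y, [], h', .nil q, by simp⟩, rfl⟩

theorem mem_underlying_evalFrom (T : Transducer α Q) (p q : Q) (w : List α) :
    q ∈ T.underlying.evalFrom {p} w ↔ ∃ v, T.Run p w v q := by
  induction w generalizing p with
  | nil => simp [run_nil_iff, eq_comm]
  | cons a w ih =>
    rw [NFA.evalFrom_cons, NFA.stepSet_singleton, NFA.mem_evalFrom_iff_exists]
    simp only [ih, run_cons_iff]
    constructor
    · rintro ⟨s, hs, v, hv⟩
      obtain ⟨x, hx⟩ := Option.isSome_iff_exists.1 hs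
      exact ⟨_, s, x, v, hx, hv, rfl⟩
    · rintro ⟨_, s, x, y, hx, hy, rfl⟩
      exact ⟨s, Option.isSome_iff_exists.2 ⟨x, hx⟩, y, hy⟩

/-- The states reached from an initial state on `w`, with the outputs of the runs. -/
def reached (T : Transducer α Q) (w : List α) : Set (Q × List α) :=
  {s | ∃ p, (T.init p).isSome ∧ T.Run p w s.2 s.1}

theorem reached_append_singleton (T : Transducer α Q) (w : List α) (a : α) :
    T.reached (w ++ [a]) = T.detImage (T.reached w) a := by
  ext s
  simp only [reached, detImage, Set.mem_ofPred_eq, run_append_singleton_iff]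
  constructor
  · rintro ⟨p, hp, t, x, y, h, h', hs⟩
    exact ⟨t, x, y, ⟨p, hp, h⟩, h', hs⟩
  · rintro ⟨t, x, y, ⟨p, hp, h⟩, h', hs⟩
    exact ⟨p, hp, t, x, y, h, h', hs⟩

theorem lcp_eq_nil_of_mem {X : Set (List α)} (h : [] ∈ X) : lcp X = [] :=
  List.prefix_nil.1 (lcp_prefix h)

theorem detInit_eq_reached (h : ∀ q x, T.init q = some x → x = []) {r : Q}
    (hr : T.init r = some []) : T.detInit = T.reached [] := by
  ext ⟨q, x⟩
  have : T.detInitWord = [] := lcp_eq_nil_of_mem ⟨r, hr⟩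
  simp only [detInit, this, reached, run_nil_iff, Set.mem_ofPred_eq, List.nil_append]
  constructor
  · intro hq
    exact ⟨q, by simp [hq], rfl, h q x hq⟩
  · rintro ⟨p, hp, rfl, rfl⟩
    obtain ⟨x, hx⟩ := Option.isSome_iff_exists.1 hp
    rwa [h _ _ hx] at hx

/-- If a state `r` is initial and can be kept without output while reading `w`, then the
determinization of `T` produces no output while reading `w`. -/
theorem exists_determinize_evalFrom (h : ∀ q x, T.init q = some x → x = []) {r : Q}
    (hr : T.init r = some []) (w : List α) (hw : ∀ a ∈ w, T.step r a r = some []) :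
    ∃ P : {P // T.DetReach P}, P.1 = T.reached w ∧
      T.determinize.underlying.evalFrom {⟨_, DetReach.init ⟨r, by simp [hr]⟩⟩} w = {P} := by
  induction w using List.reverseRecOn with
  | nil => exact ⟨_, detInit_eq_reached h hr, NFA.evalFrom_nil _ _⟩
  | append_singleton w a ih =>
    obtain ⟨P, hP, hev⟩ := ih fun b hb => hw b (by simp [hb])
    have hrun : ∀ v : List α, (∀ a ∈ v, T.step r a r = some []) → T.Run r v [] r := by
      intro v hv
      induction v with
      | nil => exact .nil r
      | cons b v ih' =>
        exact run_cons_iff.2 ⟨r, [], [], hv b (by simp), ih' fun c hc => hv c (by simp [hc]), rfl⟩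
    have hmem : (r, []) ∈ T.detImage P.1 a := by
      rw [hP, ← reached_append_singleton]
      exact ⟨r, by simp [hr], hrun _ hw⟩
    -- The silent pair `(r, [])` makes the longest common prefix empty, so nothing is stripped from
    -- the stored outputs.
    have hout : T.detOut P.1 a = [] := lcp_eq_nil_of_mem ⟨_, hmem, rfl⟩
    have hnext : T.detNext P.1 a = T.reached (w ++ [a]) := by
      rw [reached_append_singleton, ← hP]
      ext s
      simp [detNext, hout]
    refine ⟨⟨_, DetReach.step a P.2 ⟨_, hmem⟩⟩, hnext, ?_⟩
    rw [NFA.evalFrom_append, hev, NFA.evalFrom_singleton, NFA.stepSet_singleton]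
    ext P'
    have hne : (T.detImage P.1 a).Nonempty := ⟨_, hmem⟩
    simp only [underlying, determinize, hne, true_and, Set.mem_ofPred_eq, Set.mem_singleton_iff,
      Subtype.ext_iff]
    split_ifs with h' <;> simp [h']

/-- As the determinization is silent on these words, its state after each of them is the full set of
reached states with their outputs. -/
theorem reached_eq_of_transitionCon (h : ∀ q x, T.init q = some x → x = []) {r : Q}
    (hr : T.init r = some []) {v w : List α} (hv : ∀ a ∈ v, T.step r a r = some [])
    (hw : ∀ a ∈ w, T.step r a r = some [])
    (hvw : transitionCon T.determinize.underlying (FreeMonoid.ofList v) (FreeMonoid.ofList w)) :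
    T.reached v = T.reached w := by
  obtain ⟨P, hP, hev⟩ := exists_determinize_evalFrom h hr v hv
  obtain ⟨P', hP', hev'⟩ := exists_determinize_evalFrom h hr w hw
  have := hvw ⟨_, DetReach.init ⟨r, by simp [hr]⟩⟩ P
  rw [FreeMonoid.toList_ofList, FreeMonoid.toList_ofList, hev, hev'] at this
  rw [← hP, ← hP', Set.mem_singleton_iff.1 (this.1 rfl)]

/-- The deterministic transducer without output on transitions that is given by a transition
function, an initial state and a terminal function. -/
def ofTransitionFunction [DecidableEq Q] (δ : Q → α → Q) (s : Q) (t : Q → List α) :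
    Transducer α Q where
  init q := if q = s then some [] else none
  step p a q := if q = δ p a then some [] else none
  term q := some (t q)

theorem ofTransitionFunction_run_iff [DecidableEq Q] {δ : Q → α → Q} {s : Q} {t : Q → List α}
    {p q : Q} {w v : List α} :
    (ofTransitionFunction δ s t).Run p w v q ↔ q = w.foldl δ p ∧ v = [] := by
  induction w generalizing p v with
  | nil => simp [run_nil_iff, eq_comm]
  | cons a w ih =>
    rw [run_cons_iff]
    simp only [ih, List.foldl_cons]
    constructor
    · rintro ⟨r, x, y, h, ⟨rfl, rfl⟩, rfl⟩
      simp only [ofTransitionFunction, Option.ite_none_right_eq_some, Option.some.injEq] at h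
      obtain ⟨rfl, rfl⟩ := h
      exact ⟨rfl, rfl⟩
    · rintro ⟨rfl, rfl⟩
      exact ⟨δ p a, [], [], by simp [ofTransitionFunction], ⟨rfl, rfl⟩, rfl⟩

end Transducer

/-- All output is postponed to the terminal function of a deterministic automaton. -/
theorem isSubsequential_foldl {α Q : Type u} [Finite Q] (δ : Q → α → Q) (s : Q)
    (t : Q → List α) : IsSubsequential fun w => some (t (w.foldl δ s)) := by
  classical
  refine ⟨Q, inferInstance, Transducer.ofTransitionFunction δ s t, ⟨⟨s, ?_, ?_⟩, ?_⟩, ?_⟩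
  · simp [Transducer.ofTransitionFunction]
  · intro q hq
    by_contra hne
    simp [Transducer.ofTransitionFunction, hne] at hq
  · intro p a q q' h h'
    simp only [Transducer.ofTransitionFunction] at h h'
    split_ifs at h with h1
    · split_ifs at h' with h2
      · exact h1.trans h2.symm
      · simp at h'
    · simp at h
  · intro w v
    simp only [Transducer.Realizes, Transducer.ofTransitionFunction_run_iff]
    constructor
    · rintro ⟨p, q, x, y, z, hp, ⟨rfl, rfl⟩, hz, rfl⟩
      simp only [Transducer.ofTransitionFunction, Option.ite_none_right_eq_some,
        Option.some.injEq] at hp hz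
      obtain ⟨rfl, rfl⟩ := hp
      simp [hz]
    · intro h
      exact ⟨s, _, [], [], v, by simp [Transducer.ofTransitionFunction], ⟨rfl, rfl⟩, h, rfl⟩

/-! ### Unambiguous products -/

section UnambiguousProduct

variable {α M : Type u} [Monoid M]

/-- The value of a word under a morphism. -/
def wordClass (φ : FreeMonoid α →* M) (w : List α) : M := φ (FreeMonoid.ofList w)

@[simp]
theorem wordClass_nil (φ : FreeMonoid α →* M) : wordClass φ [] = 1 := map_one φ

@[simp]
theorem wordClass_append (φ : FreeMonoid α →* M) (v w : List α) :
    wordClass φ (v ++ w) = wordClass φ v * wordClass φ w := map_mul φ _ _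

theorem wordClass_cons (φ : FreeMonoid α →* M) (a : α) (w : List α) :
    wordClass φ (a :: w) = φ (FreeMonoid.of a) * wordClass φ w :=
  map_mul φ (FreeMonoid.of a) (FreeMonoid.ofList w)

/-- The context `(x, y)` and the letter `a` are reversible if some element leads back from
`(x a, y)` to `(x, a y)`. -/
def Reversible (φ : FreeMonoid α →* M) (x : M) (a : α) (y : M) : Prop :=
  ∃ k, x * φ (FreeMonoid.of a) * k = x ∧ k * φ (FreeMonoid.of a) * y = y

/-- When read from the value `x` and followed by the value `y`, the word `w` has an occurrence of
the letter `b` with value `x₀` to its left and value `y₀` to its right. -/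
def Crosses (φ : FreeMonoid α →* M) (x₀ : M) (b : α) (y₀ : M) (x : M) (w : List α) (y : M) : Prop :=
  ∃ w₁ w₂, w = w₁ ++ b :: w₂ ∧ x * wordClass φ w₁ = x₀ ∧ wordClass φ w₂ * y = y₀

theorem not_crosses_nil (φ : FreeMonoid α →* M) (x₀ : M) (b : α) (y₀ x y : M) :
    ¬Crosses φ x₀ b y₀ x [] y := by
  rintro ⟨w₁, w₂, h, -⟩
  simp at h

theorem crosses_cons_iff {φ : FreeMonoid α →* M} {x₀ : M} {b : α} {y₀ x : M} {a : α}
    {w : List α} {y : M} : Crosses φ x₀ b y₀ x (a :: w) y ↔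
      (x = x₀ ∧ a = b ∧ wordClass φ w * y = y₀) ∨
        Crosses φ x₀ b y₀ (x * φ (FreeMonoid.of a)) w y := by
  constructor
  · rintro ⟨w₁, w₂, h, h1, h2⟩
    rcases w₁ with _ | ⟨c, w₁⟩
    · obtain ⟨rfl, rfl⟩ := List.cons_eq_cons.1 h
      exact .inl ⟨by simpa using h1, rfl, h2⟩
    · obtain ⟨rfl, rfl⟩ := List.cons_eq_cons.1 h
      exact .inr ⟨w₁, w₂, rfl, by rwa [wordClass_cons, ← mul_assoc] at h1, h2⟩
  · rintro (⟨rfl, rfl, h⟩ | ⟨w₁, w₂, rfl, h1, h2⟩)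
    · exact ⟨[], w, rfl, by simp, h⟩
    · exact ⟨a :: w₁, w₂, rfl, by rwa [wordClass_cons, ← mul_assoc], h2⟩

/-- The word read between two crossings of the same triple would lead back from the first one and
witness reversibility. This is what makes the product unambiguous. -/
theorem not_crosses_of_not_reversible {φ : FreeMonoid α →* M} {x₀ : M} {b : α} {w : List α}
    {y₀ y : M} (h : ¬Reversible φ x₀ b y₀) (hy : wordClass φ w * y = y₀) :
    ¬Crosses φ x₀ b y₀ (x₀ * φ (FreeMonoid.of b)) w y := by
  rintro ⟨w₁, w₂, rfl, h1, h2⟩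
  refine h ⟨wordClass φ w₁, h1, ?_⟩
  nth_rewrite 1 [← h2]
  rw [← hy]
  simp [wordClass_cons, mul_assoc]

/-- The states of the transducer which detects a crossing: it guesses the values of the prefix and
of the suffix, or it waits for an occurrence of the additional letter. -/
inductive CrossState (M : Type u) : Type u
  | main (x y : M)
  | wait
  | done

instance [Finite M] : Finite (CrossState M) :=
  Finite.of_surjective
    (fun s : Option (Option (M × M)) => match s with
      | none => CrossState.wait
      | some none => CrossState.done
      | some (some p) => CrossState.main p.1 p.2)
    (by
      rintro (⟨x, y⟩ | _ | _)
      · exact ⟨some (some (x, y)), rfl⟩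
      · exact ⟨none, rfl⟩
      · exact ⟨some none, rfl⟩)

variable (φ : FreeMonoid α →* M) (x₀ : M) (b : α) (y₀ : M)

open Classical in
/-- The output of the detecting transducer along `w`. -/
noncomputable def crossOutput : M → List α → M → List (Option α)
  | _, [], _ => []
  | x, a :: w, y =>
    (if x = x₀ ∧ a = b ∧ wordClass φ w * y = y₀ then [none] else []) ++
      crossOutput (x * φ (FreeMonoid.of a)) w y

-- Irreversibility excludes a second occurrence of the marker.
open Classical in
theorem crossOutput_eq (h : ¬Reversible φ x₀ b y₀) (x : M) (w : List α) (y : M) :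
    crossOutput φ x₀ b y₀ x w y = if Crosses φ x₀ b y₀ x w y then [none] else [] := by
  induction w generalizing x with
  | nil => simp [crossOutput, not_crosses_nil]
  | cons a w ih =>
    rw [crossOutput, ih]
    by_cases h1 : x = x₀ ∧ a = b ∧ wordClass φ w * y = y₀
    · obtain ⟨rfl, rfl, h2⟩ := h1
      rw [if_pos ⟨rfl, rfl, h2⟩, if_neg (not_crosses_of_not_reversible h h2),
        if_pos (crosses_cons_iff.2 (.inl ⟨rfl, rfl, h2⟩))]
      rfl
    · rw [if_neg h1, List.nil_append]
      exact if_congr (by rw [crosses_cons_iff, or_iff_right h1]) rfl rfl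

open Classical in
/-- A transducer which outputs the additional letter `none` when it crosses `(x₀, b, y₀)`. -/
noncomputable def crossTransducer : Transducer (Option α) (CrossState M) where
  init
    | .main x _ => if x = 1 then some [] else none
    | .wait => some []
    | .done => none
  step
    | .main x m, some a, .main x' y =>
      if x' = x * φ (FreeMonoid.of a) ∧ m = φ (FreeMonoid.of a) * y then
        some (if x = x₀ ∧ a = b ∧ y = y₀ then [none] else []) else none
    -- This silent loop is what blocks the output of the determinization. It needs a `none` to
    -- succeed, so it keeps the transducer trim without competing with the main runs.
    | .wait, some _, .wait => some []
    | .wait, none, .done => some []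
    | .done, _, .done => some []
    | _, _, _ => none
  term
    | .main _ y => if y = 1 then some [] else none
    | .wait => none
    | .done => some []

/-- The description of the runs of the detecting transducer. -/
def CrossRun : CrossState M → List (Option α) → List (Option α) → CrossState M → Prop
  | .main x m, W, v, .main x' y => ∃ w : List α, W = w.map some ∧ x' = x * wordClass φ w ∧
      m = wordClass φ w * y ∧ v = crossOutput φ x₀ b y₀ x w y
  | .wait, W, v, .wait => none ∉ W ∧ v = []
  | .wait, W, v, .done => none ∈ W ∧ v = []
  | .done, _, v, .done => v = []
  | _, _, _, _ => False

theorem crossTransducer_run_iff (p q : CrossState M) (W v : List (Option α)) :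
    (crossTransducer φ x₀ b y₀).Run p W v q ↔ CrossRun φ x₀ b y₀ p W v q := by
  classical
  induction W generalizing p v with
  | nil =>
    rw [Transducer.run_nil_iff]
    rcases p with ⟨x, m⟩ | _ | _ <;> rcases q with ⟨x', y⟩ | _ | _
    · constructor
      · rintro ⟨h, rfl⟩
        obtain ⟨rfl, rfl⟩ := CrossState.main.inj h
        exact ⟨[], rfl, by simp, by simp, rfl⟩
      · rintro ⟨w, hw, rfl, rfl, rfl⟩
        obtain rfl := List.map_eq_nil_iff.1 hw.symm
        simp [crossOutput]
    all_goals simp [CrossRun]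
  | cons a W ih =>
    rw [Transducer.run_cons_iff]
    simp only [ih]
    rcases p with ⟨x, m⟩ | _ | _
    · rcases q with ⟨x', y⟩ | _ | _
      · constructor
        · rintro ⟨⟨x₁, m₁⟩ | _ | _, o, o', hs, hr, rfl⟩
          · obtain ⟨w, rfl, rfl, rfl, rfl⟩ := hr
            rcases a with _ | a
            · simp [crossTransducer] at hs
            · simp only [crossTransducer, Option.ite_none_right_eq_some, Option.some.injEq] at hs
              obtain ⟨⟨rfl, rfl⟩, rfl⟩ := hs
              exact ⟨a :: w, rfl, by rw [wordClass_cons, mul_assoc],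
                by rw [wordClass_cons, mul_assoc], rfl⟩
          · exact hr.elim
          · exact hr.elim
        · rintro ⟨w, hW, rfl, rfl, rfl⟩
          rcases w with _ | ⟨c, w⟩
          · simp at hW
          · obtain ⟨rfl, rfl⟩ := List.cons_eq_cons.1 hW
            refine ⟨.main (x * φ (FreeMonoid.of c)) (wordClass φ w * y), _, _, ?_,
              ⟨w, rfl, ?_, rfl, rfl⟩, rfl⟩
            · simp [crossTransducer, wordClass_cons, mul_assoc]
            · simp [wordClass_cons, mul_assoc]
      all_goals
        constructor
        · rintro ⟨⟨x₁, m₁⟩ | _ | _, o, o', hs, hr, rfl⟩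
          · exact hr.elim
          all_goals cases a <;> simp [crossTransducer] at hs
        · exact False.elim
    · rcases q with ⟨x', y⟩ | _ | _
      · constructor
        · rintro ⟨⟨x₁, m₁⟩ | _ | _, o, o', hs, hr, rfl⟩
          · cases a <;> simp [crossTransducer] at hs
          all_goals exact hr.elim
        · exact False.elim
      · constructor
        · rintro ⟨⟨x₁, m₁⟩ | _ | _, o, o', hs, hr, rfl⟩
          · exact hr.elim
          · cases a <;> simp_all [crossTransducer, CrossRun]
          · exact hr.elim
        · rintro ⟨h, rfl⟩
          rcases a with _ | a
          · simp at h
          · exact ⟨.wait, [], [], rfl, ⟨fun h' => h (List.mem_cons_of_mem _ h'), rfl⟩, rfl⟩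
      · constructor
        · rintro ⟨⟨x₁, m₁⟩ | _ | _, o, o', hs, hr, rfl⟩
          · exact hr.elim
          · cases a <;> simp_all [crossTransducer, CrossRun]
          · cases a <;> simp_all [crossTransducer, CrossRun]
        · rintro ⟨h, rfl⟩
          rcases a with _ | a
          · exact ⟨.done, [], [], rfl, rfl, rfl⟩
          · exact ⟨.wait, [], [], rfl, ⟨by simpa using h, rfl⟩, rfl⟩
    · rcases q with ⟨x', y⟩ | _ | _
      · constructor
        · rintro ⟨⟨x₁, m₁⟩ | _ | _, o, o', hs, hr, rfl⟩
          · cases a <;> simp [crossTransducer] at hs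
          all_goals exact hr.elim
        · exact False.elim
      · constructor
        · rintro ⟨⟨x₁, m₁⟩ | _ | _, o, o', hs, hr, rfl⟩
          · exact hr.elim
          · cases a <;> simp [crossTransducer] at hs
          · exact hr.elim
        · exact False.elim
      · constructor
        · rintro ⟨⟨x₁, m₁⟩ | _ | _, o, o', hs, hr, rfl⟩
          · exact hr.elim
          · cases a <;> simp [crossTransducer] at hs
          · cases a <;> simp_all [crossTransducer, CrossRun]
        · rintro rfl
          exact ⟨.done, [], [], by cases a <;> rfl, rfl, rfl⟩

open Classical in
/-- The function defined by the detecting transducer. -/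
noncomputable def crossFunction (W : List (Option α)) : Option (List (Option α)) :=
  some (if none ∉ W ∧ Crosses φ x₀ b y₀ 1 W.reduceOption 1 then [none] else [])

theorem exists_eq_map_some {W : List (Option α)} (h : none ∉ W) : ∃ w : List α, W = w.map some := by
  induction W with
  | nil => exact ⟨[], rfl⟩
  | cons a W ih =>
    obtain ⟨w, rfl⟩ := ih fun h' => h (List.mem_cons_of_mem _ h')
    rcases a with _ | a
    · simp at h
    · exact ⟨a :: w, rfl⟩

theorem reduceOption_map_some (w : List α) : (w.map some).reduceOption = w := by
  induction w with
  | nil => rfl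
  | cons a w ih => simp [List.reduceOption_cons_of_some, ih]

theorem crossTransducer_defines (h : ¬Reversible φ x₀ b y₀) :
    (crossTransducer φ x₀ b y₀).Defines (crossFunction φ x₀ b y₀) := by
  classical
  intro W v
  simp only [Transducer.Realizes, crossTransducer_run_iff]
  constructor
  · rintro ⟨p, q, o, o', o'', hp, hr, hq, rfl⟩
    rcases p with ⟨x, m⟩ | _ | _
    · rcases q with ⟨x', y⟩ | _ | _
      · obtain ⟨w, rfl, rfl, rfl, rfl⟩ := hr
        simp only [crossTransducer, Option.ite_none_right_eq_some, Option.some.injEq] at hp hq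
        obtain ⟨rfl, rfl⟩ := hp
        obtain ⟨rfl, rfl⟩ := hq
        simp [crossFunction, reduceOption_map_some, crossOutput_eq φ x₀ b y₀ h]
      all_goals exact hr.elim
    · rcases q with ⟨x', y⟩ | _ | _
      · exact hr.elim
      · simp [crossTransducer] at hq
      · obtain ⟨hW, rfl⟩ := hr
        simp only [crossTransducer, Option.some.injEq] at hp hq
        subst hp hq
        simp [crossFunction, hW]
    · simp [crossTransducer] at hp
  · intro hv
    simp only [crossFunction, Option.some.injEq] at hv
    by_cases hW : none ∈ W
    · refine ⟨.wait, .done, [], [], [], rfl, ⟨hW, rfl⟩, rfl, ?_⟩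
      simp [← hv, hW]
    · obtain ⟨w, rfl⟩ := exists_eq_map_some hW
      refine ⟨.main 1 (wordClass φ w * 1), .main (1 * wordClass φ w) 1, [], _, [],
        by simp [crossTransducer], ⟨w, rfl, rfl, rfl, rfl⟩, by simp [crossTransducer], ?_⟩
      rw [← hv, crossOutput_eq φ x₀ b y₀ h]
      simp [reduceOption_map_some]

theorem crossTransducer_isTrim (hφ : Function.Surjective φ) :
    (crossTransducer φ x₀ b y₀).IsTrim := by
  classical
  have hcl : ∀ x : M, ∃ w : List α, wordClass φ w = x := fun x =>
    (hφ x).imp fun w hw => hw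
  simp only [Transducer.IsTrim, crossTransducer_run_iff]
  rintro (⟨x, y⟩ | _ | _)
  · constructor
    · obtain ⟨w, rfl⟩ := hcl x
      exact ⟨.main 1 (wordClass φ w * y), _, _, by simp [crossTransducer], w, rfl, by simp, rfl, rfl⟩
    · obtain ⟨w, rfl⟩ := hcl y
      exact ⟨.main (x * wordClass φ w) 1, _, _, ⟨w, rfl, rfl, by simp, rfl⟩,
        by simp [crossTransducer]⟩
  · exact ⟨⟨.wait, [], [], by simp [crossTransducer], by simp [CrossRun]⟩,
      ⟨.done, [none], [], by simp [CrossRun], by simp [crossTransducer]⟩⟩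
  · exact ⟨⟨.wait, [none], [], by simp [crossTransducer], by simp [CrossRun]⟩,
      ⟨.done, [], [], rfl, by simp [crossTransducer]⟩⟩

/-- The transition function of a deterministic automaton which computes the crossings of a word
for all values of the suffix. -/
def crossStep : Option (M × Set M) → Option α → Option (M × Set M)
  | some (x, A), some a => some (x * φ (FreeMonoid.of a),
      {y | φ (FreeMonoid.of a) * y ∈ A ∨ (x = x₀ ∧ a = b ∧ y = y₀)})
  | _, _ => none

theorem foldl_crossStep_none (W : List (Option α)) :
    W.foldl (crossStep φ x₀ b y₀) none = none := by
  induction W with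
  | nil => rfl
  | cons a W ih => exact ih

theorem foldl_crossStep_map_some (w : List α) (x : M) (A : Set M) :
    (w.map some).foldl (crossStep φ x₀ b y₀) (some (x, A)) = some (x * wordClass φ w,
      {y | wordClass φ w * y ∈ A ∨ Crosses φ x₀ b y₀ x w y}) := by
  induction w generalizing x A with
  | nil => simp [not_crosses_nil]
  | cons a w ih =>
    rw [List.map_cons, List.foldl_cons, crossStep, ih]
    congr 2
    · rw [wordClass_cons, mul_assoc]
    · ext y
      simp [crosses_cons_iff, wordClass_cons, mul_assoc, or_assoc]

theorem foldl_crossStep_of_mem {W : List (Option α)} (h : none ∈ W) (s : Option (M × Set M)) :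
    W.foldl (crossStep φ x₀ b y₀) s = none := by
  induction W generalizing s with
  | nil => simp at h
  | cons a W ih =>
    rw [List.foldl_cons]
    rcases a with _ | a
    · rcases s with _ | ⟨x, A⟩ <;> exact foldl_crossStep_none φ x₀ b y₀ W
    · exact ih (by simpa using h) _

/-- The output takes only two values, and a finite deterministic automaton decides which: it stores
the prefix value and the set of suffix values for which a crossing has occurred. -/
theorem crossFunction_isSubsequential [Finite M] :
    IsSubsequential (crossFunction φ x₀ b y₀) := by
  classical
  convert isSubsequential_foldl (crossStep φ x₀ b y₀) (some (1, ∅))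
    -- At the end of the word the remaining suffix is empty, hence has value `1`.
    (fun s => if ∃ x A, s = some (x, A) ∧ (1 : M) ∈ A then [none] else []) using 1
  funext W
  rw [crossFunction]
  congr 1
  refine if_congr ?_ rfl rfl
  by_cases hW : none ∈ W
  · simp [hW, foldl_crossStep_of_mem]
  · obtain ⟨w, rfl⟩ := exists_eq_map_some hW
    rw [foldl_crossStep_map_some, reduceOption_map_some]
    simp

/-- The extension of a morphism to words with the additional letter, together with a count of the
occurrences of this letter in the powers of the value of `b`. -/
def crossHom : FreeMonoid (Option α) →* M × M :=
  FreeMonoid.lift fun a => match a with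
    | some a => (φ (FreeMonoid.of a), 1)
    | none => (1, φ (FreeMonoid.of b))

theorem crossHom_map_some (w : List α) :
    crossHom φ b (FreeMonoid.ofList (w.map some)) = (wordClass φ w, 1) := by
  induction w with
  | nil =>
    rw [wordClass_nil]
    exact map_one (crossHom φ b)
  | cons a w ih =>
    rw [List.map_cons, FreeMonoid.ofList_cons, map_mul, ih, wordClass_cons]
    simp [crossHom]

theorem crossHom_snd (W : List (Option α)) :
    (crossHom φ b (FreeMonoid.ofList W)).2 =
      φ (FreeMonoid.of b) ^ W.countP Option.isNone := by
  induction W with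
  | nil => exact (congrArg Prod.snd (map_one (crossHom φ b))).trans (pow_zero _).symm
  | cons a W ih =>
    rw [FreeMonoid.ofList_cons, map_mul, Prod.snd_mul, ih]
    rcases a with _ | a <;> simp [crossHom, pow_succ']

variable {φ x₀ b y₀}

/-- If a positive power of `φ b` were `1`, then `φ b` would be invertible and its inverse would
reverse the triple. Hence `M` itself detects the additional letter, and no other monoid needs to be
in `V`. -/
theorem crossHom_snd_eq_one_iff (h : ¬Reversible φ x₀ b y₀) (W : List (Option α)) :
    (crossHom φ b (FreeMonoid.ofList W)).2 = 1 ↔ none ∉ W := by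
  rw [crossHom_snd]
  constructor
  · intro h1 hW
    obtain ⟨n, hn⟩ := Nat.exists_eq_succ_of_ne_zero
      (List.countP_pos_iff.2 ⟨none, hW, rfl⟩ : 0 < W.countP Option.isNone).ne'
    rw [hn] at h1
    refine h ⟨φ (FreeMonoid.of b) ^ n, ?_, ?_⟩
    · rw [mul_assoc, ← pow_succ', h1, mul_one]
    · rw [← pow_succ, h1, one_mul]
  · intro hW
    rw [List.countP_eq_zero.2, pow_zero]
    rintro (_ | a) ha
    · exact absurd ha hW
    · simp

/-- Runs among the main states depend on the first component and on the absence of `none`; runs from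
the waiting state depend only on the presence of `none`, seen by the second component. -/
theorem ker_crossHom_le (h : ¬Reversible φ x₀ b y₀) :
    Con.ker (crossHom φ b) ≤ transitionCon (crossTransducer φ x₀ b y₀).underlying := by
  have key : ∀ W W' : List (Option α),
      crossHom φ b (FreeMonoid.ofList W) = crossHom φ b (FreeMonoid.ofList W') →
      ∀ p q v, CrossRun φ x₀ b y₀ p W v q → ∃ v', CrossRun φ x₀ b y₀ p W' v' q := by
    intro W W' hW p q v hr
    have hmem : none ∈ W ↔ none ∈ W' := by
      rw [← not_iff_not, ← crossHom_snd_eq_one_iff h, ← crossHom_snd_eq_one_iff h, hW]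
    rcases p with ⟨x, m⟩ | _ | _ <;> rcases q with ⟨x', y⟩ | _ | _
    · obtain ⟨w, rfl, rfl, rfl, rfl⟩ := hr
      obtain ⟨w', rfl⟩ := exists_eq_map_some (fun h' => by simpa using hmem.2 h')
      rw [crossHom_map_some, crossHom_map_some] at hW
      have hw : wordClass φ w = wordClass φ w' := (Prod.ext_iff.1 hW).1
      exact ⟨_, w', rfl, by rw [← hw], by rw [← hw], rfl⟩
    all_goals first
      | exact hr.elim
      | exact ⟨v, (not_congr hmem).1 hr.1, hr.2⟩
      | exact ⟨v, hmem.1 hr.1, hr.2⟩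
      | exact ⟨v, hr⟩
  intro W W' hW p q
  rw [Transducer.mem_underlying_evalFrom, Transducer.mem_underlying_evalFrom]
  simp only [crossTransducer_run_iff]
  exact ⟨fun ⟨v, hv⟩ => key W.toList W'.toList hW p q v hv,
    fun ⟨v, hv⟩ => key W'.toList W.toList hW.symm p q v hv⟩

/-- The run ending with guessed suffix value `1` made only correct guesses, so its output records
the crossing. -/
theorem crosses_iff_mem_reached (h : ¬Reversible φ x₀ b y₀) (w : List α) :
    Crosses φ x₀ b y₀ 1 w 1 ↔ ((.main (wordClass φ w) 1, [none]) :
      CrossState M × List (Option α)) ∈ (crossTransducer φ x₀ b y₀).reached (w.map some) := by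
  classical
  simp only [Transducer.reached, Set.mem_ofPred_eq, crossTransducer_run_iff]
  constructor
  · intro hw
    refine ⟨.main 1 (wordClass φ w), by simp [crossTransducer], w, rfl, by simp, by simp, ?_⟩
    rw [crossOutput_eq φ x₀ b y₀ h, if_pos hw]
  · rintro ⟨⟨x, y⟩ | _ | _, hp, hr⟩
    · obtain ⟨w', hw', -, -, h1⟩ := hr
      obtain rfl := List.map_injective_iff.2 (Option.some_injective α) hw'
      have hx : x = 1 := by
        by_contra hx
        simp [crossTransducer, hx] at hp
      rw [crossOutput_eq φ x₀ b y₀ h, hx] at h1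
      by_contra hw
      simp [hw] at h1
    all_goals exact hr.elim

/-- The words which cross a given irreversible context are recognized by a monoid of `V`. -/
theorem exists_con_crosses {V : MonoidClass.{u}} (hV : IsVariety V)
    (hdet : StableByDeterminization V) [Finite α] (hM : V M) (hφ : Function.Surjective φ)
    (h : ¬Reversible φ x₀ b y₀) :
    ∃ c : Con (FreeMonoid α), V c.Quotient ∧ ∀ v w : FreeMonoid α, c v w → φ v = φ w →
      (Crosses φ x₀ b y₀ 1 v.toList 1 ↔ Crosses φ x₀ b y₀ 1 w.toList 1) := by
  classical
  have := hV.finite M hM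
  obtain ⟨-, hD⟩ := hdet (Option α) (CrossState M) (crossTransducer φ x₀ b y₀)
    (crossFunction φ x₀ b y₀) (crossTransducer_isTrim φ x₀ b y₀ hφ)
    (crossTransducer_defines φ x₀ b y₀ h) (crossFunction_isSubsequential φ x₀ b y₀)
    ⟨inferInstance, hV.mono (ker_crossHom_le h) (hV.ker _ (hV.prod _ _ hM hM))⟩
  -- The additional letter has served its purpose in making the transducer trim; the congruence is
  -- restricted to words over `α`.
  let g := (transitionCon (crossTransducer φ x₀ b y₀).determinize.underlying).mk'.comp
    (FreeMonoid.map (some : α → Option α))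
  refine ⟨Con.ker g, hV.ker g hD, fun v w hvw hφvw => ?_⟩
  have hcon := (Con.eq _).1 ((Con.ker_rel g).1 hvw)
  have hr := Transducer.reached_eq_of_transitionCon (T := crossTransducer φ x₀ b y₀)
    (r := .wait) (v := v.toList.map some) (w := w.toList.map some) ?_ rfl ?_ ?_ hcon
  · rw [crosses_iff_mem_reached h, crosses_iff_mem_reached h, hr,
      show wordClass φ v.toList = wordClass φ w.toList from hφvw]
  · rintro (⟨x, y⟩ | _ | _) o ho
    · simp only [crossTransducer, Option.ite_none_right_eq_some, Option.some.injEq] at ho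
      exact ho.2.symm
    · exact (Option.some.inj ho).symm
    · simp [crossTransducer] at ho
  all_goals
    intro a ha
    obtain ⟨a, -, rfl⟩ := List.mem_map.1 ha
    rfl

end UnambiguousProduct

/-! ### Delays of a rational function -/

namespace Transducer

variable {α Q : Type u}

/-- A run from an initial state to `s`, with the initial output. -/
def InitialRun (T : Transducer α Q) (w X : List α) (s : Q) : Prop :=
  ∃ p x y, T.init p = some x ∧ T.Run p w y s ∧ X = x ++ y

/-- A run from `s` to a final state, with the terminal output. -/
def FinalRun (T : Transducer α Q) (s : Q) (w O : List α) : Prop :=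
  ∃ q y z, T.Run s w y q ∧ T.term q = some z ∧ O = y ++ z

variable {T : Transducer α Q}

theorem realizes_append_iff {v w y : List α} :
    T.Realizes (v ++ w) y ↔ ∃ s X O, T.InitialRun v X s ∧ T.FinalRun s w O ∧ y = X ++ O := by
  simp only [Realizes, run_append_iff]
  constructor
  · rintro ⟨p, q, x, _, z, hp, ⟨s, y, y', h, h', rfl⟩, hq, rfl⟩
    exact ⟨s, x ++ y, y' ++ z, ⟨p, x, y, hp, h, rfl⟩, ⟨q, y', z, h', hq, rfl⟩, by simp⟩
  · rintro ⟨s, _, _, ⟨p, x, y, hp, h, rfl⟩, ⟨q, y', z, h', hq, rfl⟩, rfl⟩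
    exact ⟨p, q, x, y ++ y', z, hp, ⟨s, y, y', h, h', rfl⟩, hq, by simp⟩

theorem InitialRun.exists_of_transitionCon {v w X : List α} {s : Q} (h : T.InitialRun v X s)
    (hvw : transitionCon T.underlying (FreeMonoid.ofList v) (FreeMonoid.ofList w)) :
    ∃ Y, T.InitialRun w Y s := by
  obtain ⟨p, x, y, hp, hr, rfl⟩ := h
  have := (hvw p s).1 ((mem_underlying_evalFrom T p s v).2 ⟨y, hr⟩)
  obtain ⟨y', hy'⟩ := (mem_underlying_evalFrom T p s w).1 this
  exact ⟨_, p, x, y', hp, hy', rfl⟩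

theorem FinalRun.exists_of_transitionCon {v w O : List α} {s : Q} (h : T.FinalRun s v O)
    (hvw : transitionCon T.underlying (FreeMonoid.ofList v) (FreeMonoid.ofList w)) :
    ∃ O', T.FinalRun s w O' := by
  obtain ⟨q, y, z, hr, hq, rfl⟩ := h
  have := (hvw s q).1 ((mem_underlying_evalFrom T s q v).2 ⟨y, hr⟩)
  obtain ⟨y', hy'⟩ := (mem_underlying_evalFrom T s q w).1 this
  exact ⟨_, q, y', z, hy', hq, rfl⟩

/-- After any `x`, both words can be completed from the same intermediate state. The two outputs
then share the part produced on `x`, and the remaining parts can be chosen depending on the state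
only, so finitely many states give a bound. -/
theorem Defines.leftSyntactic_of_transitionCon [Finite Q] {f : List α → Option (List α)}
    (hf : T.Defines f) {v w : List α}
    (hvw : transitionCon T.underlying (FreeMonoid.ofList v) (FreeMonoid.ofList w)) :
    (leftSyntactic f).r v w := by
  classical
  have hdom : ∀ {v w : List α},
      transitionCon T.underlying (FreeMonoid.ofList v) (FreeMonoid.ofList w) →
      ∀ x, (f (x ++ v)).isSome → (f (x ++ w)).isSome := by
    intro v w hvw x h
    obtain ⟨y, hy⟩ := Option.isSome_iff_exists.1 h
    obtain ⟨s, X, O, hX, hO, rfl⟩ := realizes_append_iff.1 ((hf _ _).2 hy)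
    obtain ⟨O', hO'⟩ := hO.exists_of_transitionCon hvw
    rw [(hf _ _).1 (realizes_append_iff.2 ⟨s, X, O', hX, hO', rfl⟩)]
    rfl
  refine ⟨fun x => ⟨hdom hvw x, hdom (Con.symm _ hvw) x⟩, ?_⟩
  have hch : ∀ (s : Q) (u : List α), ∃ O, (∃ O', T.FinalRun s u O') → T.FinalRun s u O := by
    intro s u
    by_cases h : ∃ O', T.FinalRun s u O'
    · exact ⟨h.choose, fun _ => h.choose_spec⟩
    · exact ⟨[], fun h' => (h h').elim⟩
  choose O hO using hch
  obtain ⟨K, hK⟩ := (Set.finite_range fun s => (O s v).length + (O s w).length).bddAbove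
  refine ⟨K, fun x y z hy hz => ?_⟩
  obtain ⟨s, X, o, hX, ho, rfl⟩ := realizes_append_iff.1 ((hf _ _).2 hy)
  have h1 := (hf _ _).1 (realizes_append_iff.2 ⟨s, X, _, hX, hO s v ⟨o, ho⟩, rfl⟩)
  have h2 := (hf _ _).1 (realizes_append_iff.2
    ⟨s, X, _, hX, hO s w (ho.exists_of_transitionCon hvw), rfl⟩)
  obtain rfl := Option.some.inj (hz.symm.trans h2)
  rw [Option.some.inj (hy.symm.trans h1)]
  exact (leftDist_append_le _ _ _).trans (hK ⟨s, rfl⟩)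

end Transducer

section Delay

variable {α M : Type u} [Monoid M]

/-- The values of `f` on products factor through the classes of the two factors: after `v` and `v'`
with the same class, and before `w` and `w'` with the same class, the outputs can be split
simultaneously. -/
def Factorizes (φ : FreeMonoid α →* M) (f : List α → Option (List α)) : Prop :=
  ∀ {v v' w w' : List α}, wordClass φ v = wordClass φ v' → wordClass φ w = wordClass φ w' →
    (f (v ++ w)).isSome → ∃ X X' Y Y', f (v ++ w) = some (X ++ Y) ∧ f (v' ++ w) = some (X' ++ Y) ∧
      f (v ++ w') = some (X ++ Y') ∧ f (v' ++ w') = some (X' ++ Y')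

/-- Cut a successful run at a state `s`: either half can be replaced by one on an equivalent word
with the same end states. -/
theorem Transducer.Defines.factorizes {Q : Type u} {T : Transducer α Q}
    {f : List α → Option (List α)} (hf : T.Defines f) :
    Factorizes (transitionCon T.underlying).mk' f := by
  intro v v' w w' hv hw h
  obtain ⟨y, hy⟩ := Option.isSome_iff_exists.1 h
  obtain ⟨s, X, Y, hX, hY, rfl⟩ := realizes_append_iff.1 ((hf _ _).2 hy)
  obtain ⟨X', hX'⟩ := hX.exists_of_transitionCon ((Con.eq _).1 hv)
  obtain ⟨Y', hY'⟩ := hY.exists_of_transitionCon ((Con.eq _).1 hw)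
  exact ⟨X, X', Y, Y', hy, (hf _ _).1 (realizes_append_iff.2 ⟨s, _, _, hX', hY, rfl⟩),
    (hf _ _).1 (realizes_append_iff.2 ⟨s, _, _, hX, hY', rfl⟩),
    (hf _ _).1 (realizes_append_iff.2 ⟨s, _, _, hX', hY', rfl⟩)⟩

/-- The value of `f` in the free group, and `1` outside of the domain. -/
def groupValue (f : List α → Option (List α)) (w : List α) : FreeGroup α :=
  wordToGroup ((f w).getD [])

/-- The delay between `f (w z)` and `f (w z')`. -/
def delay (f : List α → Option (List α)) (w z z' : List α) : FreeGroup α :=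
  (groupValue f (w ++ z))⁻¹ * groupValue f (w ++ z')

theorem delay_append (f : List α → Option (List α)) (w u z z' : List α) :
    delay f (w ++ u) z z' = delay f w (u ++ z) (u ++ z') := by
  simp [delay]

variable {φ : FreeMonoid α →* M} {f : List α → Option (List α)}

theorem Factorizes.isSome (hf : Factorizes φ f) {v v' w w' : List α}
    (hv : wordClass φ v = wordClass φ v') (hw : wordClass φ w = wordClass φ w')
    (h : (f (v ++ w)).isSome) : (f (v' ++ w')).isSome := by
  obtain ⟨X, X', Y, Y', -, -, -, h4⟩ := hf hv hw h
  rw [h4]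
  rfl

/-- The output of the right factor cancels, so the ratio depends on the right factor only through
its class. -/
theorem Factorizes.groupValue_mul_inv (hf : Factorizes φ f) {v v' w w' : List α}
    (hv : wordClass φ v = wordClass φ v') (hw : wordClass φ w = wordClass φ w')
    (h : (f (v ++ w)).isSome) :
    groupValue f (v ++ w) * (groupValue f (v' ++ w))⁻¹ =
      groupValue f (v ++ w') * (groupValue f (v' ++ w'))⁻¹ := by
  obtain ⟨X, X', Y, Y', h1, h2, h3, h4⟩ := hf hv hw h
  simp only [groupValue, h1, h2, h3, h4, Option.getD_some, wordToGroup_append]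
  group

theorem leftSyntactic_append {z z' : List α} (h : (leftSyntactic f).r z z') (u : List α) :
    (leftSyntactic f).r (u ++ z) (u ++ z') := by
  induction u with
  | nil => exact h
  | cons a u ih => exact (leftSyntactic f).cons a ih

theorem finite_range_delay [Finite α] {z z' : List α} (h : (leftSyntactic f).r z z') :
    {g | ∃ w, (f (w ++ z)).isSome ∧ g = delay f w z z'}.Finite := by
  obtain ⟨hd, K, hK⟩ := h
  refine (finite_wordToGroup_quotients K).subset ?_
  rintro _ ⟨w, hw, rfl⟩
  obtain ⟨y, hy⟩ := Option.isSome_iff_exists.1 hw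
  obtain ⟨y', hy'⟩ := Option.isSome_iff_exists.1 ((hd w).1 hw)
  exact ⟨y, y', hK w y y' hy hy', by simp [delay, groupValue, hy, hy']⟩

theorem wordClass_flatten_replicate_append {t z : List α}
    (h : wordClass φ (t ++ z) = wordClass φ z) (n : ℕ) :
    wordClass φ ((List.replicate n t).flatten ++ z) = wordClass φ z := by
  induction n with
  | zero => simp
  | succ n ih =>
    rw [List.replicate_succ, List.flatten_cons, List.append_assoc, wordClass_append, ih,
      ← wordClass_append, h]

/-- Iterating a loop multiplies the value by a power of a fixed element. -/
theorem Factorizes.groupValue_loop (hf : Factorizes φ f) {w t z : List α}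
    (hw : wordClass φ (w ++ t) = wordClass φ w) (hz : wordClass φ (t ++ z) = wordClass φ z)
    (h : (f (w ++ z)).isSome) (n : ℕ) :
    groupValue f (w ++ ((List.replicate n t).flatten ++ z)) =
      (groupValue f (w ++ t ++ z) * (groupValue f (w ++ z))⁻¹) ^ n * groupValue f (w ++ z) := by
  induction n with
  | zero => simp
  | succ n ih =>
    have key := hf.groupValue_mul_inv hw
      (wordClass_flatten_replicate_append hz n).symm (hf.isSome hw.symm rfl h)
    rw [pow_succ', mul_assoc, ← ih, key]
    simp [List.replicate_succ]

/-- By the pigeonhole principle two exponents give the same element, hence `a ^ k = b ^ k` for some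
`k > 0`, and roots are unique. -/
theorem eq_of_finite_range_pow {G : Type*} [Group G] [IsMulTorsionFree G] {a b : G} {s : Set G}
    (hs : s.Finite) (h : ∀ n : ℕ, (a ^ n)⁻¹ * b ^ n ∈ s) : a = b := by
  have := hs.to_subtype
  obtain ⟨m, n, hmn, heq⟩ := Finite.exists_ne_map_eq_of_infinite
    fun n : ℕ => (⟨_, h n⟩ : s)
  replace heq : (a ^ m)⁻¹ * b ^ m = (a ^ n)⁻¹ * b ^ n := congrArg Subtype.val heq
  clear this h
  wlog hlt : m < n generalizing m n
  · exact this n m hmn.symm heq.symm (by omega)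
  obtain ⟨k, rfl⟩ := Nat.exists_eq_add_of_le hlt.le
  have hk : a ^ k = b ^ k := by
    rw [add_comm, pow_add, pow_add, mul_inv_rev, mul_assoc, mul_right_inj, ← mul_assoc,
      right_eq_mul, inv_mul_eq_one] at heq
    exact heq
  exact pow_left_injective (by omega) hk

/-- Iterating `t` multiplies the two outputs on the left by powers of fixed elements `a` and `b`.
Finiteness of the set of delays forces `a = b`, and this factor cancels in the delay. -/
theorem Factorizes.delay_loop [Finite α] (hf : Factorizes φ f) {w t z z' : List α}
    (hzz' : (leftSyntactic f).r z z') (hw : wordClass φ (w ++ t) = wordClass φ w)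
    (hz : wordClass φ (t ++ z) = wordClass φ z) (hz' : wordClass φ (t ++ z') = wordClass φ z')
    (h : (f (w ++ z)).isSome) : delay f (w ++ t) z z' = delay f w z z' := by
  have h' := (hzz'.1 w).1 h
  have key : groupValue f (w ++ t ++ z) * (groupValue f (w ++ z))⁻¹ =
      groupValue f (w ++ t ++ z') * (groupValue f (w ++ z'))⁻¹ := by
    -- The delay after `n` iterations is `f(wz)⁻¹ a⁻ⁿ bⁿ f(wz')`; the image solves this for `a⁻ⁿ
    -- bⁿ`.
    refine eq_of_finite_range_pow ((finite_range_delay hzz').image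
      fun g => groupValue f (w ++ z) * g * (groupValue f (w ++ z'))⁻¹) fun n => ?_
    refine ⟨_, ⟨w ++ (List.replicate n t).flatten, ?_, rfl⟩, ?_⟩
    · rw [List.append_assoc]
      exact hf.isSome rfl (wordClass_flatten_replicate_append hz n).symm h
    · rw [delay, List.append_assoc, List.append_assoc, hf.groupValue_loop hw hz h,
        hf.groupValue_loop hw hz' h']
      group
  rw [mul_inv_eq_iff_eq_mul] at key
  rw [delay, key, delay]
  group

/-- Both sides are compared with the context `w u' k u`: deleting the loop `u' k` leaves `w u`,
deleting the loop `k u` leaves `w u'`. -/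
theorem Factorizes.delay_eq_of_return [Finite α] (hf : Factorizes φ f) {w u u' k z z' : List α}
    (hzz' : (leftSyntactic f).r z z') (hw : wordClass φ (w ++ u) = wordClass φ (w ++ u'))
    (hz : wordClass φ (u ++ z) = wordClass φ (u' ++ z))
    (hz' : wordClass φ (u ++ z') = wordClass φ (u' ++ z'))
    (hwk : wordClass φ (w ++ u ++ k) = wordClass φ w)
    (hkz : wordClass φ (k ++ u ++ z) = wordClass φ z)
    (hkz' : wordClass φ (k ++ u ++ z') = wordClass φ z')
    (h : (f (w ++ u ++ z)).isSome) : delay f (w ++ u) z z' = delay f (w ++ u') z z' := by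
  have hwk' : wordClass φ (w ++ (u' ++ k)) = wordClass φ w := by
    rw [← List.append_assoc, wordClass_append, ← hw, ← wordClass_append, hwk]
  have h1 : delay f (w ++ (u' ++ k)) (u ++ z) (u ++ z') = delay f w (u ++ z) (u ++ z') := by
    refine hf.delay_loop (leftSyntactic_append hzz' u) hwk' ?_ ?_ (by simpa using h)
    · simpa [mul_assoc, hz] using congrArg (wordClass φ u' * ·) hkz
    · simpa [mul_assoc, hz'] using congrArg (wordClass φ u' * ·) hkz'
  have h2 : delay f (w ++ u' ++ (k ++ u)) z z' = delay f (w ++ u') z z' := by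
    refine hf.delay_loop hzz' ?_ hkz hkz' (hf.isSome hw rfl h)
    rw [← List.append_assoc, List.append_assoc w, wordClass_append, hwk', ← wordClass_append, hw]
  rw [← h2, delay_append f w u, ← h1, ← delay_append]
  simp

end Delay

/-! ### Delays and irreversible crossings -/

section Crossings

variable {α M : Type u} [Monoid M] {φ : FreeMonoid α →* M} {f : List α → Option (List α)}

/-- Either one can return after reading `w`, or `w` has a first irreversible letter. -/
theorem exists_return_or_irreversible (φ : FreeMonoid α →* M) (x : M) (w : List α) (y : M) :
    (∃ k, x * wordClass φ w * k = x ∧ k * wordClass φ w * y = y) ∨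
      ∃ w₁ b w₂, w = w₁ ++ b :: w₂ ∧
        ¬Reversible φ (x * wordClass φ w₁) b (wordClass φ w₂ * y) ∧
        ∃ k, x * wordClass φ w₁ * k = x ∧
          k * wordClass φ w₁ * (wordClass φ (b :: w₂) * y) = wordClass φ (b :: w₂) * y := by
  induction w generalizing x with
  | nil => exact .inl ⟨1, by simp, by simp⟩
  | cons a w ih =>
    by_cases ha : Reversible φ x a (wordClass φ w * y)
    · obtain ⟨k₁, h1, h2⟩ := ha
      rcases ih (x * φ (FreeMonoid.of a)) with ⟨k, h3, h4⟩ | ⟨w₁, b, w₂, rfl, hb, k, h3, h4⟩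
      · refine .inl ⟨k * k₁, ?_, ?_⟩
        · rw [wordClass_cons, ← mul_assoc, ← mul_assoc, h3, h1]
        · rw [wordClass_cons]
          simp only [mul_assoc] at h2 h4 ⊢
          rw [h2, h4]
      · refine .inr ⟨a :: w₁, b, w₂, rfl, ?_, k * k₁, ?_, ?_⟩
        · rwa [wordClass_cons, ← mul_assoc]
        · rw [wordClass_cons, ← mul_assoc, ← mul_assoc, h3, h1]
        · rw [wordClass_cons φ a w₁]
          rw [wordClass_append] at h2
          simp only [mul_assoc] at h2 h4 ⊢
          rw [h2, h4]
    · exact .inr ⟨[], a, w, rfl, by simpa using ha, 1, by simp, by simp⟩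

/-- All irreversible crossings of `w` are crossings of `w'`. -/
def CrossesLE (φ : FreeMonoid α →* M) (x : M) (w w' : List α) : Prop :=
  ∀ x₀ b y₀, ¬Reversible φ x₀ b y₀ → Crosses φ x₀ b y₀ x w 1 → Crosses φ x₀ b y₀ x w' 1

/-- After a common irreversible crossing, the crossings of the remaining suffixes are still
comparable. -/
theorem CrossesLE.suffix {x : M} {b : α} {v v' w w' : List α}
    (h : CrossesLE φ x (v ++ b :: w) (v' ++ b :: w'))
    (hv : x * wordClass φ v = x * wordClass φ v') (hw : wordClass φ w = wordClass φ w') :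
    CrossesLE φ (x * wordClass φ v' * φ (FreeMonoid.of b)) w w' := by
  rintro x₀ c y₀ hc hcw
  obtain ⟨s, s', rfl, h1, h2⟩ := id hcw
  rw [← hv] at h1
  obtain ⟨t, t', ht, h3, h4⟩ := h x₀ c y₀ hc ⟨v ++ b :: s, s', by simp, by
    rw [wordClass_append, wordClass_cons, ← h1]
    simp only [mul_assoc], h2⟩
  rcases List.append_eq_append_iff.1 ht with ⟨r, rfl, hr⟩ | ⟨r, rfl, hr⟩
  · rcases r with _ | ⟨d, r⟩
    -- The matching crossing in the second word is the distinguished letter itself; then `w` would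
    -- cross the same irreversible triple again.
    · obtain ⟨rfl, rfl⟩ := List.cons_eq_cons.1 hr
      rw [List.append_nil] at h3
      rw [h3] at hcw
      exact (not_crosses_of_not_reversible hc (by rw [hw, h4]) hcw).elim
    · obtain ⟨rfl, rfl⟩ := List.cons_eq_cons.1 hr
      exact ⟨r, t', rfl, by rw [← h3, wordClass_append, wordClass_cons]; simp only [mul_assoc], h4⟩
  · rcases r with _ | ⟨d, r⟩
    · obtain ⟨rfl, rfl⟩ := List.cons_eq_cons.1 hr
      rw [List.append_nil, h3] at hcw
      exact (not_crosses_of_not_reversible hc (by rw [hw, h4]) hcw).elim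
    · rw [List.cons_append] at hr
      obtain ⟨rfl, rfl⟩ := List.cons_eq_cons.1 hr
      -- The matching crossing lies before the distinguished letter. Reading on to that letter in
      -- the second word, and then to the crossing in the first, leads back to the same triple.
      refine (hc ⟨wordClass φ (r ++ b :: s), ?_, ?_⟩).elim
      · rw [hv] at h1
        rw [← h3]
        simp only [wordClass_append, wordClass_cons, mul_assoc] at h1 h3 ⊢
        rw [h1, h3]
      · rw [mul_one] at h2 h4
        nth_rewrite 1 [← h2]
        rw [← h4]
        simp only [wordClass_append, wordClass_cons, mul_assoc] at hw ⊢
        rw [hw]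

/-- If one can return after `u`, the loop argument applies directly. Otherwise `u'` has a crossing
matching the first irreversible letter of `u`: the returnable parts before it are exchanged by the
loop argument, and the shorter remainders are compared by induction. -/
theorem Factorizes.delay_eq_of_crossesLE [Finite α] (hφ : Function.Surjective φ)
    (hf : Factorizes φ f) {p u u' z z' : List α} (hu : wordClass φ u = wordClass φ u')
    (hc : CrossesLE φ (wordClass φ p) u u') (hzz' : (leftSyntactic f).r z z')
    (h : (f (p ++ u ++ z)).isSome) : delay f (p ++ u) z z' = delay f (p ++ u') z z' := by
  induction hn : u.length using Nat.strong_induction_on generalizing p u u' with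
  | _ n ih =>
  rcases exists_return_or_irreversible φ (wordClass φ p) u 1 with
    ⟨k, h1, h2⟩ | ⟨u₁, b, u₂, rfl, hb, k, h1, h2⟩
  · obtain ⟨k, rfl⟩ := hφ k
    change _ * _ * wordClass φ k.toList = _ at h1
    change wordClass φ k.toList * _ * _ = _ at h2
    rw [mul_one] at h2
    exact hf.delay_eq_of_return hzz' (by simp [hu]) (by simp [hu]) (by simp [hu]) (k := k.toList)
      (by simpa [mul_assoc] using h1) (by rw [wordClass_append, wordClass_append, h2, one_mul])
      (by rw [wordClass_append, wordClass_append, h2, one_mul]) h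
  · obtain ⟨u₁', u₂', rfl, h3, h4⟩ := hc _ b _ hb ⟨u₁, u₂, rfl, rfl, rfl⟩
    rw [mul_one, mul_one] at h4
    obtain ⟨k, rfl⟩ := hφ k
    change _ * _ * wordClass φ k.toList = _ at h1
    change wordClass φ k.toList * _ * _ = _ at h2
    have hu₂ : wordClass φ (b :: u₂) = wordClass φ (b :: u₂') := by
      rw [wordClass_cons, wordClass_cons, h4]
    have hw : wordClass φ (p ++ u₁) = wordClass φ (p ++ u₁') := by simp [h3]
    have hz : ∀ z, wordClass φ (u₁ ++ (b :: u₂ ++ z)) = wordClass φ (u₁' ++ (b :: u₂ ++ z)) := by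
      intro z
      rw [wordClass_append, wordClass_append, ← hu₂] at hu
      rw [wordClass_append, wordClass_append, ← mul_assoc, hu, mul_assoc, ← wordClass_append,
        ← wordClass_append]
    have hk : ∀ z, wordClass φ (k.toList ++ u₁ ++ (b :: u₂ ++ z)) =
        wordClass φ (b :: u₂ ++ z) := by
      intro z
      rw [mul_one] at h2
      rw [wordClass_append, wordClass_append, wordClass_append, ← mul_assoc, h2]
    have step := hf.delay_eq_of_return (leftSyntactic_append hzz' (b :: u₂)) hw (hz z) (hz z')
      (k := k.toList) (by simpa [mul_assoc] using h1) (hk z) (hk z') (by simpa using h)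
    have hdom : (f (p ++ u₁' ++ [b] ++ u₂ ++ z)).isSome := by
      have := hf.isSome (v := p ++ u₁) (w := b :: u₂ ++ z) hw rfl (by simpa using h)
      simpa using this
    have hrec := ih u₂.length (by simp [← hn]; omega) (p := p ++ u₁' ++ [b]) (u := u₂) (u' := u₂')
      h4.symm (by
        have := hc.suffix h3.symm h4.symm
        rw [wordClass_append, wordClass_append]
        exact this) hdom rfl
    rw [← delay_append, ← delay_append] at step
    simpa using step.trans (by simpa using hrec)

end Crossings

/-! ### Outputs of the canonical bimachine -/

section Canonical

variable {α : Type u}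

/-- For related words, the values of a function on a class of suffixes are the same up to a change
of prefix. -/
theorem exists_common_values {M : Type u} [Monoid M] {φ : FreeMonoid α →* M}
    {f : List α → Option (List α)} (hf : Factorizes φ f) {v w : List α}
    (hvw : wordClass φ v = wordClass φ w)
    (hd : ∀ z z', (leftSyntactic f).r z z' → (f (v ++ z)).isSome → delay f v z z' = delay f w z z')
    (r : (leftSyntactic f).Classes) :
    ∃ (p q : List α) (g : List α → Option (List α)),
      ∀ z, Quotient.mk (leftSyntactic f).toSetoid z = r →
        f (v ++ z) = (g z).map (p ++ ·) ∧ f (w ++ z) = (g z).map (q ++ ·) := by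
  classical
  let J := {z : List α // Quotient.mk (leftSyntactic f).toSetoid z = r ∧ (f (v ++ z)).isSome}
  have hnone : ∀ z, f (v ++ z) = none → f (w ++ z) = none := by
    intro z hz
    by_contra hcon
    have := hf.isSome hvw.symm rfl (Option.isSome_iff_ne_none.2 hcon)
    simp [hz] at this
  by_cases hJ : Nonempty J
  · obtain ⟨p, q, c, hp, hq⟩ := exists_common_suffixes
      (fun z : J => (f (v ++ z.1)).getD []) (fun z : J => (f (w ++ z.1)).getD [])
      (fun i j => hd i.1 j.1 (Quotient.exact (i.2.1.trans j.2.1.symm)) i.2.2)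
    -- The common suffix is defined on the part of the class in the domain, which is the same after
    -- `v` and after `w`.
    refine ⟨p, q, fun z => if h : _ then some (c ⟨z, h⟩) else none, fun z hz => ?_⟩
    by_cases h : (f (v ++ z)).isSome
    · have h' := hf.isSome hvw rfl h
      have h1 := hp ⟨z, hz, h⟩
      have h2 := hq ⟨z, hz, h⟩
      obtain ⟨y, hy⟩ := Option.isSome_iff_exists.1 h
      obtain ⟨y', hy'⟩ := Option.isSome_iff_exists.1 h'
      simp only [hy, hy', Option.getD_some] at h1 h2
      simp only [hz, h, and_self, dif_pos, Option.map_some]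
      exact ⟨hy.trans (congrArg some h1), hy'.trans (congrArg some h2)⟩
    · rw [Option.not_isSome_iff_eq_none] at h
      simp [h, hnone z h]
  · refine ⟨[], [], fun _ => none, fun z hz => ?_⟩
    have h : f (v ++ z) = none := by
      rw [← Option.not_isSome_iff_eq_none]
      exact fun h => hJ ⟨z, hz, h⟩
    simp [h, hnone z h]

theorem fhat_eq_map (f g : List α → Option (List α)) (R : LeftCongruence α) (r : R.Classes)
    (w p : List α) (h : ∀ z, Quotient.mk R.toSetoid z = r → f (w ++ z) = (g z).map (p ++ ·)) :
    fhat f R r w = (fhat g R r []).map (p ++ ·) := by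
  have hset : {y | ∃ v, Quotient.mk R.toSetoid v = r ∧ f (w ++ v) = some y} =
      (p ++ ·) '' {y | ∃ v, Quotient.mk R.toSetoid v = r ∧ g ([] ++ v) = some y} := by
    ext y
    constructor
    · rintro ⟨z, hz, hy⟩
      rw [h z hz] at hy
      obtain ⟨y', hy', rfl⟩ := Option.map_eq_some_iff.1 hy
      exact ⟨y', ⟨z, hz, hy'⟩, rfl⟩
    · rintro ⟨y, ⟨z, hz, hy⟩, rfl⟩
      exact ⟨z, hz, by rw [h z hz, show g z = some y from hy]; rfl⟩
  unfold fhat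
  rw [hset]
  by_cases hne : {y | ∃ v, Quotient.mk R.toSetoid v = r ∧ g ([] ++ v) = some y}.Nonempty
  · rw [if_pos hne, if_pos (hne.image _), lcp_image_append _ hne]
    rfl
  · rw [if_neg hne, if_neg (by rwa [Set.image_nonempty])]
    rfl

theorem bind_leftQuotient_map (p : List α) (x y : Option (List α)) :
    ((x.map (p ++ ·)).bind fun x => (y.map (p ++ ·)).bind fun y => leftQuotient x y) =
      x.bind fun x => y.bind fun y => leftQuotient x y := by
  cases x <;> cases y <;> simp [leftQuotient_append]

variable {f : List α → Option (List α)} {R : LeftCongruence α} {v w : List α}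

/-- Prepending `a` maps the class `r` into `a r`, so both longest common prefixes in the output
carry the same prefix change, which the left quotient removes. -/
theorem omegaWord_eq_of_common_values {a : α} {r : R.Classes} (h : ∃ (p q : List α)
    (g : List α → Option (List α)), ∀ z, Quotient.mk R.toSetoid z = R.act a r →
      f (v ++ z) = (g z).map (p ++ ·) ∧ f (w ++ z) = (g z).map (q ++ ·)) :
    omegaWord f R v a r = omegaWord f R w a r := by
  obtain ⟨p, q, g, hg⟩ := h
  have hcons : ∀ z, Quotient.mk R.toSetoid z = r →
      Quotient.mk R.toSetoid (a :: z) = R.act a r := by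
    rintro z rfl
    rfl
  unfold omegaWord
  rw [fhat_eq_map f g R _ v p fun z hz => (hg z hz).1,
    fhat_eq_map f g R _ w q fun z hz => (hg z hz).2,
    fhat_eq_map f (fun z => g (a :: z)) R r (v ++ [a]) p
      fun z hz => by simpa using (hg _ (hcons z hz)).1,
    fhat_eq_map f (fun z => g (a :: z)) R r (w ++ [a]) q
      fun z hz => by simpa using (hg _ (hcons z hz)).2,
    bind_leftQuotient_map, bind_leftQuotient_map]

theorem rhoWord_eq_of_common_values (h : ∃ (p q : List α)
    (g : List α → Option (List α)), ∀ z, Quotient.mk R.toSetoid z = Quotient.mk R.toSetoid [] →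
      f (v ++ z) = (g z).map (p ++ ·) ∧ f (w ++ z) = (g z).map (q ++ ·)) :
    rhoWord f R v = rhoWord f R w := by
  obtain ⟨p, q, g, hg⟩ := h
  unfold rhoWord
  rw [fhat_eq_map f g R _ v p fun z hz => (hg z hz).1,
    fhat_eq_map f g R _ w q fun z hz => (hg z hz).2,
    show f v = (g []).map (p ++ ·) by simpa using (hg [] rfl).1,
    show f w = (g []).map (q ++ ·) by simpa using (hg [] rfl).2,
    bind_leftQuotient_map, bind_leftQuotient_map]

end Canonical

end RationalFunctions

open RationalFunctions in
theorem mainTheorem5 (V : RationalFunctions.MonoidClass.{u})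
    (hV : RationalFunctions.IsVariety V)
    (hdet : RationalFunctions.StableByDeterminization V)
    {α Q : Type u} [Finite α] (f : List α → Option (List α))
    (T : RationalFunctions.Transducer α Q)
    (hT : RationalFunctions.IsVTransducer V T) (hf : T.Defines f) :
    RationalFunctions.IsVBimachine V (RationalFunctions.canonicalBimachine f) := by
  obtain ⟨hQ, hM⟩ := hT
  let φ := (transitionCon T.underlying).mk'
  have hφ : Function.Surjective φ := Con.mk'_surjective
  have hfac : Factorizes φ f := hf.factorizes
  have := hV.finite _ hM
  have hcross : ∀ t : {t : (transitionCon T.underlying).Quotient × α ×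
        (transitionCon T.underlying).Quotient // ¬Reversible φ t.1 t.2.1 t.2.2},
      ∃ c : Con (FreeMonoid α), V c.Quotient ∧ ∀ v w : FreeMonoid α, c v w → φ v = φ w →
        (Crosses φ t.1.1 t.1.2.1 t.1.2.2 1 v.toList 1 ↔
          Crosses φ t.1.1 t.1.2.1 t.1.2.2 1 w.toList 1) :=
    fun t => exists_con_crosses hV hdet hM hφ t.2
  choose c hcV hc using hcross
  -- There are finitely many triples, as `M` and the alphabet are finite.
  obtain ⟨d, hdV, hd⟩ := hV.exists_le_of_finite c hcV
  obtain ⟨e, heV, he1, he2⟩ := hV.exists_le_inf hdV hM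
  refine ⟨RightCongruence.isVAutomaton hV _ heV ?_,
    LeftCongruence.isRightVAutomaton hV _ hM fun v w h => hf.leftSyntactic_of_transitionCon h⟩
  have key : ∀ v w : FreeMonoid α, e v w → ∀ r, ∃ (p q : List α) (g : List α → Option (List α)),
      ∀ z, Quotient.mk (leftSyntactic f).toSetoid z = r →
        f (v.toList ++ z) = (g z).map (p ++ ·) ∧ f (w.toList ++ z) = (g z).map (q ++ ·) := by
    intro v w hvw r
    have hφvw : φ v = φ w := (Con.eq _).2 (he2 hvw)
    refine exists_common_values hfac hφvw (fun z z' hzz' h => ?_) r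
    refine hfac.delay_eq_of_crossesLE hφ (p := []) hφvw ?_ hzz' h
    intro x₀ b y₀ hb hcr
    rw [wordClass_nil] at hcr ⊢
    exact (hc ⟨(x₀, b, y₀), hb⟩ v w (hd _ (he1 hvw)) hφvw).1 hcr
  intro v w hvw x
  -- The continuation `x` in the right congruence is absorbed because `e` is two-sided.
  have hx : e (v * FreeMonoid.ofList x) (w * FreeMonoid.ofList x) := e.mul hvw (e.refl _)
  exact ⟨fun a r => omegaWord_eq_of_common_values (key _ _ hx _),
    rhoWord_eq_of_common_values (key _ _ hx _)⟩
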